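/- Let $d\ge 2$, $p\in[0,1]$, $q\in[1,\infty)$, and $p^*=p^*(p)=\frac{(1-p)q}{(1-p)q+p}$. Let $\Lambda_N=[-N,N]^d$, regarded as a cubical complex with the unit cubes with integer corners as cells, and write $-\log 0=+\infty$. *Plaquette random-cluster model (PRCM).* Let $E_N$ be the set of $(d-1)$-cells (plaquettes) of $\Lambda_N$ that are not contained in $\partial\Lambda_N$. A set $P\subseteq E_N$ is identified with the complex formed by $P$ and all cells of $\Lambda_N$ of dimension at most $d-2$. The $(d-1)$-dimensional PRCM on $\Lambda_N$ with free boundary conditions is $$\mu^{\mathbf f}_{\Lambda_N,p,q}(P)\propto p^{|P|}(1-p)^{|E_N|-|P|}\,q^{\dim \tilde H_{d-2}(P;\mathbb Q)} .$$ Let $R$ be a nontrivial ring with unity (for instance $\mathbb Z$ or $\mathbb Z/m\mathbb Z$, $m\ge2$), let $\gamma_N=\partial\big([-N,N]^{d-1}\times\{0\}\big)$, as a $(d-2)$-cycle, and let $V_{\gamma_N}$ be the event that $\gamma_N=\partial\alpha$ for some $\alpha\in C_{d-1}(P;R)$. The Wilson loop tension is $$\tau''_{p,q}=\lim_{N\to\infty}\frac{-\log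 \mu^{\mathbf f}_{\Lambda_N,p,q}(V_{\gamma_N})}{(2N)^{d-1}} .$$ *Surface tension.* For $p'\in[0,1]$ let $\mu^{\mathbf w}_{\Lambda_N,p',q,1}$ be the classical random-cluster model with wired boundary conditions on the set $B_N$ of edges of $\Lambda_N$ not contained in $\partial\Lambda_N$, that is, $\mu^{\mathbf w}_{\Lambda_N,p',q,1}(Q)\propto p'^{|Q|}(1-p')^{|B_N|-|Q|}q^{k(Q)}$ for $Q\subseteq B_N$, where $k(Q)$ is the number of connected components of the graph whose vertices are the lattice points of $\Lambda_N$ and whose edges are those of $Q$ together with all edges contained in $\partial\Lambda_N$. Let $\partial^{\pm}\Lambda_N=\{x\in\partial\Lambda_N:\pm x_d>0\}$. The surface tension is $$\tau_{p',q}=\lim_{N\to\infty}\frac{-\log \mu^{\mathbf w}_{\Lambda_N,p',q,1}\big(\text{no path in } Q \text{ joins } \partial^+\Lambda_N \text{ to } \partial^-\Lambda_N\big)}{(2N)^{d-1}} .$$ *Infinite-volume PRCMs.* Every plaquette $\sigma$ of $\mathbb Z^d$ meets, at its centre, exactly one edge $\sigma^\bullet$ of the dual lattice $\mathbb Z^d+(\tfrac12,\dots,\tfrac12)$.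 For a set $\xi$ of plaquettes of $\mathbb Z^d$ outside $E_N$, the PRCM $\mu^{\xi}_{\Lambda_N,p,q}$ on $\Lambda_N$ with boundary condition $\xi$ is the law of the random set $P\subseteq E_N$ for which $Q=\{\sigma^\bullet:\sigma\in E_N\setminus P\}$ has the law of the classical random-cluster model with parameters $p^*,q$ on all edges of the dual box $[-N+\tfrac12,N-\tfrac12]^d$ and with boundary condition $\{\sigma^\bullet:\sigma\notin E_N\cup\xi\}$; here the random-cluster weight counts the connected components, meeting the dual box, of the graph formed by $Q$ and the edges of the boundary condition. An infinite-volume PRCM with parameters $p,q$ is a probability measure on sets of plaquettes of $\mathbb Z^d$ that is a weak limit of the laws of $P\cup\xi_k$, where $P$ has law $\mu^{\xi_k}_{\Lambda_{N_k},p,q}$, for some $N_k\to\infty$ and some boundary conditions $\xi_k$. **Proposition.** Suppose that $p$ and $q$ are such that there is exactly one infinite-volume $(d-1)$-dimensional PRCM with parameters $p,q$. Then the limits $\tau''_{p,q}$ and $\tau_{p^*(p),q}$ exist in $[0,\infty]$, are finite if $p>0$, and $$\tau''_{p,q}=\tau_{p^*(p),q}.$$ In particular $\tau''_{p,q}$ does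 not depend on $R$. -/

import Mathlib

open Filter Topology MeasureTheory
open scoped BoundedContinuousFunction

namespace PRCM

noncomputable section

/-! ### Cells of the cubical complex `ℤ^d` -/

/-- Points of `ℤ^d`. -/
abbrev Vertex (d : ℕ) : Type := Fin d → ℤ

/-- The pair `(x, S)` is the elementary cube `∏_{m ∈ S} [x m, x m + 1] × ∏_{m ∉ S} {x m}`, a cell
of dimension `S.card`. -/
abbrev Cell (d : ℕ) : Type := Vertex d × Finset (Fin d)

/-- The pair `(x, j)` is the unit segment from `x` to `x + e_j`. -/
abbrev Edge (d : ℕ) : Type := Vertex d × Fin d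

/-- The pair `(x, j)` is the `(d-1)`-dimensional plaquette `{x j} × ∏_{m ≠ j} [x m, x m + 1]`,
orthogonal to `e_j`. -/
abbrev Plaquette (d : ℕ) : Type := Vertex d × Fin d

/-- The cell underlying an edge. -/
def edgeCell {d : ℕ} (b : Edge d) : Cell d := (b.1, {b.2})

/-- The cell underlying a `(d-1)`-plaquette. -/
def plaqCell {d : ℕ} (σ : Plaquette d) : Cell d := (σ.1, Finset.univ.erase σ.2)

/-- The cell `σ` is contained in the cube `Λ_N = [-N, N]^d`. -/
def InBox {d : ℕ} (N : ℕ) (σ : Cell d) : Prop :=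
  ∀ m, -(N : ℤ) ≤ σ.1 m ∧ (if m ∈ σ.2 then σ.1 m + 1 else σ.1 m) ≤ (N : ℤ)

/-- The cell `σ` is contained in the topological boundary `∂Λ_N`, that is, in a face of `Λ_N`. -/
def InBoxBoundary {d : ℕ} (N : ℕ) (σ : Cell d) : Prop :=
  InBox N σ ∧ ∃ m, m ∉ σ.2 ∧ (σ.1 m = -(N : ℤ) ∨ σ.1 m = (N : ℤ))

/-- The lattice points of `Λ_N`. -/
def boxVertices (d N : ℕ) : Finset (Vertex d) :=
  Finset.Icc (fun _ => -(N : ℤ)) (fun _ => (N : ℤ))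

open Classical in
/-- The edges of `Λ_N` that are not contained in `∂Λ_N`. -/
def boxEdges (d N : ℕ) : Finset (Edge d) :=
  (boxVertices d N ×ˢ Finset.univ).filter
    fun b => InBox N (edgeCell b) ∧ ¬ InBoxBoundary N (edgeCell b)

open Classical in
/-- The `(d-1)`-plaquettes of `Λ_N` that are not contained in `∂Λ_N`. -/
def boxPlaquettes (d N : ℕ) : Finset (Plaquette d) :=
  (boxVertices d N ×ˢ Finset.univ).filter
    fun σ => InBox N (plaqCell σ) ∧ ¬ InBoxBoundary N (plaqCell σ)

/-! ### Cubical chains and homology -/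

/-- The cubical boundary operator: the `j`-th direction of a cell, being its `l`-th one in increasing
order, contributes `(-1)^(l-1)` times (upper face minus lower face). -/
def cellBoundary (R : Type*) [Ring R] (d : ℕ) : (Cell d →₀ R) →ₗ[R] (Cell d →₀ R) :=
  Finsupp.linearCombination R fun σ : Cell d =>
    ∑ j ∈ σ.2, (-1 : R) ^ (σ.2.filter (· < j)).card •
      (Finsupp.single ((σ.1 + Pi.single j 1, σ.2.erase j) : Cell d) (1 : R)
        - Finsupp.single ((σ.1, σ.2.erase j) : Cell d) (1 : R))

/-- The chains `C_k(X; R)`. -/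
def chains (R : Type*) [Ring R] {d : ℕ} (X : Set (Cell d)) (k : ℕ) : Submodule R (Cell d →₀ R) :=
  Finsupp.supported R R {σ | σ ∈ X ∧ σ.2.card = k}

/-- The cycles of the reduced chain complex: a `0`-chain has to be in the kernel of the
augmentation. -/
def reducedCycles (R : Type*) [Ring R] {d : ℕ} (X : Set (Cell d)) (k : ℕ) :
    Submodule R (Cell d →₀ R) :=
  chains R X k ⊓ LinearMap.ker (cellBoundary R d) ⊓
    (if k = 0 then LinearMap.ker (Finsupp.linearCombination R fun _ : Cell d => (1 : R)) else ⊤)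

/-- The boundaries `B_k(X; R)`. -/
def boundaries (R : Type*) [Ring R] {d : ℕ} (X : Set (Cell d)) (k : ℕ) :
    Submodule R (Cell d →₀ R) :=
  (chains R X (k + 1)).map (cellBoundary R d)

/-- The Betti number `b_k(X; ℚ)`, the dimension of the reduced homology `H_k(X; ℚ)`. -/
def reducedBetti {d : ℕ} (X : Set (Cell d)) (k : ℕ) : ℕ :=
  Module.finrank ℚ
    (reducedCycles ℚ X k ⧸ (boundaries ℚ X k).submoduleOf (reducedCycles ℚ X k))

/-! ### Finite-volume measures given by weights -/

/-- The expectation of `f` under the probability measure on the subsets of the finite set `E` whose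
density is proportional to `w`. -/
def gibbsMean {α : Type*} (E : Finset α) (w : Finset α → ℝ) (f : Finset α → ℝ) : ℝ :=
  (∑ P ∈ E.powerset, w P * f P) / ∑ P ∈ E.powerset, w P

/-- The probability of the event `A` under the same measure. -/
def gibbsProb {α : Type*} (E : Finset α) (w : Finset α → ℝ) (A : Set (Finset α)) : ℝ :=
  gibbsMean E w (A.indicator 1)

/-! ### The `(d-1)`-dimensional plaquette random-cluster model, free boundary conditions -/

/-- The percolation subcomplex of `Λ_N` (`d ≥ 2`) with the set `P` of `(d-1)`-plaquettes: it
contains all cells of `Λ_N` of dimension at most `d - 2`. -/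
def percComplex (d N : ℕ) (P : Finset (Plaquette d)) : Set (Cell d) :=
  {σ | InBox N σ ∧ σ.2.card ≤ d - 2} ∪ plaqCell '' (P : Set (Plaquette d))

/-- The weight `p^|P| (1-p)^(|Λ_N| - |P|) q^(b_{d-2}(P; ℚ))`. -/
def prcmWeight (d N : ℕ) (p q : ℝ) (P : Finset (Plaquette d)) : ℝ :=
  p ^ P.card * (1 - p) ^ ((boxPlaquettes d N).card - P.card)
    * q ^ reducedBetti (percComplex d N P) (d - 2)

/-- The probability of `A` under `μ^f_{Λ_N, p, q, d-1}`. -/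
def prcmFreeProb (d N : ℕ) (p q : ℝ) (A : Set (Finset (Plaquette d))) : ℝ :=
  gibbsProb (boxPlaquettes d N) (prcmWeight d N p q) A

open Classical in
/-- The `(d-1)`-chain of the box `[-N, N]^(d-1) × {0}`, the coordinate that vanishes being the
`e`-th. -/
def equatorDisc (R : Type*) [Ring R] (d N : ℕ) (e : Fin d) : Cell d →₀ R :=
  ∑ σ ∈ (boxPlaquettes d N).filter (fun σ => σ.2 = e ∧ σ.1 e = 0), Finsupp.single (plaqCell σ) 1

/-- The `(d-2)`-cycle `γ_N = ∂([-N, N]^(d-1) × {0})`. -/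
def equator (R : Type*) [Ring R] (d N : ℕ) (e : Fin d) : Cell d →₀ R :=
  cellBoundary R d (equatorDisc R d N e)

/-- The event `V_{γ_N}` that `γ_N` is a boundary in `P` with coefficients in `R`. -/
def loopBounds (R : Type*) [Ring R] (d N : ℕ) (e : Fin d) : Set (Finset (Plaquette d)) :=
  {P | equator R d N e ∈ boundaries R (percComplex d N P) (d - 2)}

/-! ### The classical random-cluster model with boundary conditions -/

/-- The graph on `ℤ^d` with edge set `η`. -/
def edgeGraph {d : ℕ} (η : Set (Edge d)) : SimpleGraph (Vertex d) :=
  SimpleGraph.fromRel fun x y => ∃ j, (x, j) ∈ η ∧ y = x + Pi.single j 1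

/-- The number of connected components of the graph with edge set `η` that meet `S`. -/
def numClusters {d : ℕ} (η : Set (Edge d)) (S : Finset (Vertex d)) : ℕ :=
  ((edgeGraph η).connectedComponentMk '' (S : Set (Vertex d))).ncard

/-- The random-cluster weight of a set `Q ⊆ E` of open edges of a finite graph with vertex set `S`
and edge set `E`, with boundary condition `ξ`: the edges of `ξ` are used, in addition to those of
`Q`, for counting the components that meet `S`. -/
def rcmWeight {d : ℕ} (p q : ℝ) (S : Finset (Vertex d)) (E : Finset (Edge d)) (ξ : Set (Edge d))
    (Q : Finset (Edge d)) : ℝ :=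
  p ^ Q.card * (1 - p) ^ (E.card - Q.card) * q ^ numClusters ((Q : Set (Edge d)) ∪ ξ) S

/-- The probability of `A` under the wired measure `μ^w_{Λ_N, p, q, 1}`: the random edges are those
of `Λ_N` not contained in `∂Λ_N`, and the edges in `∂Λ_N` are added for counting components. -/
def rcmWiredProb (d N : ℕ) (p q : ℝ) (A : Set (Finset (Edge d))) : ℝ :=
  gibbsProb (boxEdges d N)
    (rcmWeight p q (boxVertices d N) (boxEdges d N) {b | InBoxBoundary N (edgeCell b)}) A

/-- The event that no open path joins `∂⁺Λ_N = ∂Λ_N ∩ {x_e > 0}` to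
`∂⁻Λ_N = ∂Λ_N ∩ {x_e < 0}`. -/
def hemispheresDisconnected (d N : ℕ) (e : Fin d) : Set (Finset (Edge d)) :=
  {Q | ∀ x y : Vertex d,
    InBoxBoundary N ((x, ∅) : Cell d) → InBoxBoundary N ((y, ∅) : Cell d) →
    0 < x e → y e < 0 → ¬ (edgeGraph (Q : Set (Edge d))).Reachable x y}

/-! ### Duality, boundary conditions, and infinite-volume measures -/

/-- The dual parameter `p*`. -/
def dualParam (p q : ℝ) : ℝ := (1 - p) * q / ((1 - p) * q + p)

/-- The edge of the dual lattice `ℤ^d + (1/2, …, 1/2)` that crosses the plaquette `σ` at its centre.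
The dual vertex `y + (1/2, …, 1/2)` is represented by `y`. -/
def dualEdge {d : ℕ} (σ : Plaquette d) : Edge d := (σ.1 - Pi.single σ.2 1, σ.2)

/-- The dual vertices in `[-N + 1/2, N - 1/2]^d`. -/
def dualBoxVertices (d N : ℕ) : Finset (Vertex d) :=
  Finset.Icc (fun _ => -(N : ℤ)) (fun _ => (N : ℤ) - 1)

/-- The density, up to a constant, of the `(d-1)`-dimensional PRCM on `Λ_N` with boundary condition
`ξ` (only the plaquettes of `ξ` outside `boxPlaquettes d N` matter). It is the weight of the dual
configuration `Q` in the classical random-cluster model with parameter `p*` on the dual box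
`[-N + 1/2, N - 1/2]^d`, all of whose edges are random, with the dual boundary condition. -/
def prcmBCWeight (d N : ℕ) (p q : ℝ) (ξ : Set (Plaquette d)) (P : Finset (Plaquette d)) : ℝ :=
  rcmWeight (dualParam p q) q (dualBoxVertices d N) ((boxPlaquettes d N).image dualEdge)
    (dualEdge '' {σ | σ ∉ boxPlaquettes d N ∧ σ ∉ ξ}) ((boxPlaquettes d N \ P).image dualEdge)

/-- Configurations of `(d-1)`-plaquettes of `ℤ^d`, with the product topology and `σ`-algebra. -/
abbrev Config (d : ℕ) : Type := Plaquette d → Bool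

open Classical in
/-- The configuration that is `P` on `Λ_N` and `ξ` outside. -/
def extendConfig {d : ℕ} (N : ℕ) (ξ : Set (Plaquette d)) (P : Finset (Plaquette d)) : Config d :=
  fun σ => decide (if σ ∈ boxPlaquettes d N then σ ∈ P else σ ∈ ξ)

/-- `μ` is an infinite-volume `(d-1)`-dimensional PRCM: a weak limit of finite-volume PRCM measures
with arbitrary boundary conditions on cubes that increase to `ℤ^d`. -/
def IsInfiniteVolumePRCM (d : ℕ) (p q : ℝ) (μ : ProbabilityMeasure (Config d)) : Prop :=
  ∃ (N : ℕ → ℕ) (ξ : ℕ → Set (Plaquette d)), Tendsto N atTop atTop ∧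
    ∀ f : Config d →ᵇ ℝ,
      Tendsto
        (fun k => gibbsMean (boxPlaquettes d (N k)) (prcmBCWeight d (N k) p q (ξ k))
          fun P => f (extendConfig (N k) (ξ k) P))
        atTop (𝓝 (∫ ω, f ω ∂(μ : Measure (Config d))))

/-! ### The two tensions -/

/-- `-log P / (2N)^(d-1)`, with `-log 0 = +∞`. -/
def decayRate (d N : ℕ) (P : ℝ) : EReal :=
  -ENNReal.log (ENNReal.ofReal P) / (((2 * (N : ℝ)) ^ (d - 1) : ℝ) : EReal)

/-- `τ''_{p,q} = τ`, where `V_γ` is taken with coefficients in `R`. -/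
def IsWilsonLoopTension (R : Type*) [Ring R] (d : ℕ) (e : Fin d) (p q : ℝ) (τ : EReal) : Prop :=
  Tendsto (fun N : ℕ => decayRate d N (prcmFreeProb d N p q (loopBounds R d N e))) atTop (𝓝 τ)

/-- `τ_{p,q} = τ`, the surface tension of the classical random-cluster model. -/
def IsSurfaceTension (d : ℕ) (e : Fin d) (p q : ℝ) (τ : EReal) : Prop :=
  Tendsto (fun N : ℕ => decayRate d N (rcmWiredProb d N p q (hemispheresDisconnected d N e)))
    atTop (𝓝 τ)

end

end PRCM

open PRCM

namespace PRCM

noncomputable section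

/-! ### Correlation inequalities for finite Gibbs measures -/

section Gibbs

variable {α β : Type*}

/-! Both tensions are decay rates of one kind of event, the existence of an interface in a
random-cluster model with parameter p* whose outside vertices are all wired together. An interface
(`separated`) is a vertex set that equals the half-space {x_e ≥ 0} outside a finite set I and that
no open edge leaves.

On the Wilson loop side, d-cells are indexed by dual vertices, and the coefficient of ∂β at a
plaquette is, up to sign, the jump of β across its dual edge. The box has no homology in codimension
one, so the cycles carried by P are exactly the boundaries of functions that vanish on the outer
layer of dual vertices and are constant on dual clusters (`map_clusterFns`). Over ℚ, rank-nullity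
then turns the Betti number in the weight into a cluster count, and free plaquette boundary
conditions become wired dual ones (`prcmWeight_eq`). Over any nontrivial R, the same description of
cycles turns V_γ into the existence of an interface (`mem_loopBounds_iff`). Hence the probability of
V_γ equals `dualBoxSepProb`, in which R does not occur.

On the surface tension side, disconnection of the two hemispheres is the existence of an interface,
up to closing the edges at the equator. There are O(N^(d-2)) of these, which is negligible at
surface order.

For p > 0, so that p* < 1, the comparison rests on gluing (`prod_sepProb_mul_le`). Interfaces in
non-adjacent tiles are joined along the hyperplane by closing the vertical edges that cross it
outside the tiles, at a cost of at most one factor 1 - p* for each such edge. FKG multiplies the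
probabilities, and wiring farther away only favours interfaces. Gluing many tiles makes
`cubeSepProb` approximately supermultiplicative, so a Fekete argument yields a finite rate. Gluing a
single tile compares cubes with dual boxes of almost equal size, which therefore share that rate
(`exists_common_rate`).

For p = 0 every dual edge is open, both events have probability zero, and both tensions are
infinite. -/

open Classical in
theorem gibbsProb_eq (E : Finset α) (w : Finset α → ℝ) (A : Set (Finset α)) :
    gibbsProb E w A = (∑ P ∈ E.powerset.filter (· ∈ A), w P) / ∑ P ∈ E.powerset, w P := by
  unfold gibbsProb gibbsMean
  rw [Finset.sum_filter]
  congr 1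
  refine Finset.sum_congr rfl fun P _ => ?_
  by_cases h : P ∈ A <;> simp [h]

theorem gibbsProb_nonneg {E : Finset α} {w : Finset α → ℝ} (hw : ∀ P, 0 ≤ w P)
    (A : Set (Finset α)) : 0 ≤ gibbsProb E w A := by
  classical
  rw [gibbsProb_eq]
  exact div_nonneg (Finset.sum_nonneg fun _ _ => hw _) (Finset.sum_nonneg fun _ _ => hw _)

theorem gibbsProb_mono {E : Finset α} {w : Finset α → ℝ} (hw : ∀ P, 0 ≤ w P)
    {A B : Set (Finset α)} (h : ∀ P ⊆ E, P ∈ A → P ∈ B) : gibbsProb E w A ≤ gibbsProb E w B := by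
  classical
  rw [gibbsProb_eq, gibbsProb_eq]
  refine div_le_div_of_nonneg_right ?_ (Finset.sum_nonneg fun _ _ => hw _)
  refine Finset.sum_le_sum_of_subset_of_nonneg ?_ fun _ _ _ => hw _
  intro P hP
  simp only [Finset.mem_filter, Finset.mem_powerset] at hP ⊢
  exact ⟨hP.1, h P hP.1 hP.2⟩

theorem gibbsProb_univ {E : Finset α} {w : Finset α → ℝ} (hw : ∑ P ∈ E.powerset, w P ≠ 0) :
    gibbsProb E w Set.univ = 1 := by
  classical
  rw [gibbsProb_eq]
  simp [div_self hw]

theorem gibbsProb_le_one {E : Finset α} {w : Finset α → ℝ} (hw : ∀ P, 0 ≤ w P)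
    (A : Set (Finset α)) : gibbsProb E w A ≤ 1 := by
  classical
  rw [gibbsProb_eq]
  refine div_le_one_of_le₀ ?_ (Finset.sum_nonneg fun _ _ => hw _)
  exact Finset.sum_le_sum_of_subset_of_nonneg (Finset.filter_subset _ _) fun _ _ _ => hw _

/-- Transport of a Gibbs measure along a bijection of configurations. -/
theorem gibbsProb_congr {E : Finset α} {F : Finset β} {w : Finset α → ℝ} {v : Finset β → ℝ}
    {A : Set (Finset α)} {B : Set (Finset β)} {c : ℝ} (hc : c ≠ 0)
    (i : Finset α → Finset β) (j : Finset β → Finset α)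
    (hi : ∀ P ⊆ E, i P ⊆ F) (hj : ∀ Q ⊆ F, j Q ⊆ E)
    (hji : ∀ P ⊆ E, j (i P) = P) (hij : ∀ Q ⊆ F, i (j Q) = Q)
    (hw : ∀ P ⊆ E, w P = c * v (i P)) (hA : ∀ P ⊆ E, (P ∈ A ↔ i P ∈ B)) :
    gibbsProb E w A = gibbsProb F v B := by
  classical
  have key : ∀ f : Finset α → ℝ, ∀ g : Finset β → ℝ, (∀ P ⊆ E, f P = c * g (i P)) →
      ∑ P ∈ E.powerset, f P = c * ∑ Q ∈ F.powerset, g Q := by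
    intro f g hfg
    rw [Finset.mul_sum]
    refine Finset.sum_nbij' i j ?_ ?_ ?_ ?_ ?_ <;> simp only [Finset.mem_powerset]
    · exact hi
    · exact hj
    · exact hji
    · exact hij
    · exact hfg
  unfold gibbsProb gibbsMean
  rw [key _ _ hw, key _ (fun Q => v Q * B.indicator 1 Q), mul_div_mul_left _ _ hc]
  intro P hP
  by_cases h : P ∈ A
  · have h' := (hA P hP).1 h
    simp [h, h', hw P hP]
  · have h' : i P ∉ B := fun h' => h ((hA P hP).2 h')
    simp [h, h', hw P hP]

theorem isLowerSet_disjoint (F : Finset α) : IsLowerSet {Q : Finset α | Disjoint Q F} :=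
  fun _ _ h hQ => hQ.mono_left h

variable [DecidableEq α]

theorem sum_powerset_inter_sdiff {E E' : Finset α} (hE : E ⊆ E') (f g : Finset α → ℝ) :
    ∑ P ∈ E'.powerset, f (P ∩ E) * g (P \ E)
      = (∑ P ∈ E.powerset, f P) * ∑ P ∈ (E' \ E).powerset, g P := by
  rw [Finset.sum_mul_sum, ← Finset.sum_product']
  refine Finset.sum_nbij' (fun P => (P ∩ E, P \ E)) (fun a => a.1 ∪ a.2) ?_ ?_ ?_ ?_ ?_
  · intro P hP
    simp only [Finset.mem_powerset, Finset.mem_product] at hP ⊢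
    exact ⟨Finset.inter_subset_right, Finset.sdiff_subset_sdiff hP le_rfl⟩
  · rintro ⟨a, b⟩ hP
    simp only [Finset.mem_powerset, Finset.mem_product] at hP ⊢
    exact Finset.union_subset (hP.1.trans hE) (hP.2.trans Finset.sdiff_subset)
  · intro P _
    ext x
    simp only [Finset.mem_union, Finset.mem_inter, Finset.mem_sdiff]
    tauto
  · rintro ⟨a, b⟩ hP
    simp only [Finset.mem_powerset, Finset.mem_product] at hP
    have h2 : ∀ x ∈ b, x ∉ E := fun x hx => (Finset.mem_sdiff.1 (hP.2 hx)).2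
    refine Prod.ext ?_ ?_
    · ext x
      have := @hP.1 x
      have := h2 x
      simp only [Finset.mem_union, Finset.mem_inter]
      tauto
    · ext x
      have := @hP.1 x
      have := h2 x
      simp only [Finset.mem_union, Finset.mem_sdiff]
      tauto
  · intro P _
    rfl

/-- The marginal on `E` of a Gibbs measure on `E'` whose weight factorizes. -/
theorem gibbsProb_restrict {E E' : Finset α} (hE : E ⊆ E') {w w' v : Finset α → ℝ}
    (hv : ∑ P ∈ (E' \ E).powerset, v P ≠ 0)
    (hw : ∀ P ⊆ E', w' P = w (P ∩ E) * v (P \ E)) (A : Set (Finset α)) :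
    gibbsProb E' w' {P | P ∩ E ∈ A} = gibbsProb E w A := by
  classical
  have h1 : ∑ P ∈ E'.powerset, w' P
      = (∑ P ∈ E.powerset, w P) * ∑ P ∈ (E' \ E).powerset, v P := by
    rw [← sum_powerset_inter_sdiff hE]
    exact Finset.sum_congr rfl fun P hP => hw P (Finset.mem_powerset.1 hP)
  have h2 : ∑ P ∈ E'.powerset, w' P * ({P | P ∩ E ∈ A} : Set (Finset α)).indicator 1 P
      = (∑ P ∈ E.powerset, w P * A.indicator 1 P) * ∑ P ∈ (E' \ E).powerset, v P := by
    rw [← sum_powerset_inter_sdiff hE]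
    refine Finset.sum_congr rfl fun P hP => ?_
    rw [hw P (Finset.mem_powerset.1 hP)]
    by_cases h : P ∩ E ∈ A <;> simp [h]
  unfold gibbsProb gibbsMean
  rw [h1, h2, mul_div_mul_right _ _ hv]

/-- Holley's inequality: the first measure dominates the second, so that it gives less mass to
decreasing events. -/
theorem gibbsProb_le_of_holley {E : Finset α} {w₁ w₂ : Finset α → ℝ}
    (h1 : ∀ P, 0 ≤ w₁ P) (h2 : ∀ P, 0 ≤ w₂ P)
    (hp1 : 0 < ∑ P ∈ E.powerset, w₁ P) (hp2 : 0 < ∑ P ∈ E.powerset, w₂ P)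
    (h : ∀ s ⊆ E, ∀ t ⊆ E, w₁ s * w₂ t ≤ w₂ (s ∩ t) * w₁ (s ∪ t))
    {A : Set (Finset α)} (hA : IsLowerSet A) : gibbsProb E w₁ A ≤ gibbsProb E w₂ A := by
  classical
  rw [gibbsProb_eq, gibbsProb_eq, div_le_div_iff₀ hp1 hp2]
  -- The two families are A and all subsets of E. Since A is decreasing, every meet stays in A; for
  -- the joins the total mass suffices as a bound.
  refine (Finset.four_functions_theorem E (f₁ := w₁) (f₂ := w₂) (f₃ := w₂) (f₄ := w₁) h1 h2 h2 h1
    (fun s hs t ht => h s hs t ht) (Finset.filter_subset (· ∈ A) _) le_rfl).trans ?_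
  refine mul_le_mul ?_ ?_ (Finset.sum_nonneg fun _ _ => h1 _) (Finset.sum_nonneg fun _ _ => h2 _)
  · refine Finset.sum_le_sum_of_subset_of_nonneg ?_ fun _ _ _ => h2 _
    intro P hP
    obtain ⟨a, ha, b, hb, rfl⟩ := Finset.mem_infs.1 hP
    simp only [Finset.mem_filter, Finset.mem_powerset] at ha hb ⊢
    exact ⟨Finset.inter_subset_left.trans ha.1, hA (Finset.inter_subset_left : a ∩ b ⊆ a) ha.2⟩
  · refine Finset.sum_le_sum_of_subset_of_nonneg ?_ fun _ _ _ => h1 _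
    intro P hP
    obtain ⟨a, ha, b, hb, rfl⟩ := Finset.mem_sups.1 hP
    simp only [Finset.mem_filter, Finset.mem_powerset] at ha hb ⊢
    exact Finset.union_subset ha.1 hb

/-- Weights satisfying the FKG lattice condition on the subsets of `E`. -/
structure IsFKGWeight (E : Finset α) (w : Finset α → ℝ) : Prop where
  nonneg : ∀ P, 0 ≤ w P
  sum_pos : 0 < ∑ P ∈ E.powerset, w P
  lattice : ∀ s ⊆ E, ∀ t ⊆ E, w s * w t ≤ w (s ∩ t) * w (s ∪ t)

variable {E : Finset α} {w : Finset α → ℝ}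

/-- The four functions theorem with all four functions equal to w. For decreasing events the meets
lie in both, and the joins are bounded by the total mass. -/
theorem IsFKGWeight.mul_le_inter (hw : IsFKGWeight E w) {A B : Set (Finset α)}
    (hA : IsLowerSet A) (hB : IsLowerSet B) :
    gibbsProb E w A * gibbsProb E w B ≤ gibbsProb E w (A ∩ B) := by
  classical
  rw [gibbsProb_eq, gibbsProb_eq, gibbsProb_eq, div_mul_div_comm,
    div_le_div_iff₀ (mul_pos hw.sum_pos hw.sum_pos) hw.sum_pos, ← mul_assoc]
  refine mul_le_mul_of_nonneg_right ?_ hw.sum_pos.le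
  refine (Finset.four_functions_theorem E (f₁ := w) (f₂ := w) (f₃ := w) (f₄ := w)
    hw.nonneg hw.nonneg hw.nonneg hw.nonneg
    (fun s hs t ht => hw.lattice s hs t ht) (Finset.filter_subset (· ∈ A) _)
    (Finset.filter_subset (· ∈ B) _)).trans ?_
  refine mul_le_mul ?_ ?_ (Finset.sum_nonneg fun _ _ => hw.nonneg _)
    (Finset.sum_nonneg fun _ _ => hw.nonneg _)
  · refine Finset.sum_le_sum_of_subset_of_nonneg ?_ fun _ _ _ => hw.nonneg _
    intro P hP
    obtain ⟨a, ha, b, hb, rfl⟩ := Finset.mem_infs.1 hP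
    simp only [Finset.mem_filter, Finset.mem_powerset] at ha hb ⊢
    exact ⟨Finset.inter_subset_left.trans ha.1,
      hA (Finset.inter_subset_left : a ∩ b ⊆ a) ha.2,
      hB (Finset.inter_subset_right : a ∩ b ⊆ b) hb.2⟩
  · refine Finset.sum_le_sum_of_subset_of_nonneg ?_ fun _ _ _ => hw.nonneg _
    intro P hP
    obtain ⟨a, ha, b, hb, rfl⟩ := Finset.mem_sups.1 hP
    simp only [Finset.mem_filter, Finset.mem_powerset] at ha hb ⊢
    exact Finset.union_subset ha.1 hb.1

theorem IsFKGWeight.prod_le_iInter (hw : IsFKGWeight E w) {ι : Type*} (T : Finset ι)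
    {A : ι → Set (Finset α)} (hA : ∀ t ∈ T, IsLowerSet (A t)) :
    ∏ t ∈ T, gibbsProb E w (A t) ≤ gibbsProb E w (⋂ t ∈ T, A t) := by
  classical
  induction T using Finset.induction_on with
  | empty => simp [gibbsProb_univ hw.sum_pos.ne']
  | insert a T ha ih =>
    rw [Finset.prod_insert ha, Finset.set_biInter_insert]
    refine (mul_le_mul_of_nonneg_left (ih fun t ht => hA t (Finset.mem_insert_of_mem ht))
      (gibbsProb_nonneg hw.nonneg _)).trans ?_
    refine hw.mul_le_inter (hA a (Finset.mem_insert_self _ _)) ?_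
    exact isLowerSet_iInter₂ fun t ht => hA t (Finset.mem_insert_of_mem ht)

/-- Finite energy: pairing Q with `insert e Q` shows that each edge is closed with probability at
least 1 - p. Closing an edge is a decreasing event, so positive correlation multiplies these bounds.
-/
theorem IsFKGWeight.pow_le_disjoint (hw : IsFKGWeight E w) {p : ℝ} (hp1 : p ≤ 1)
    (hins : ∀ e ∈ E, ∀ Q ⊆ E, e ∉ Q → (1 - p) * w (insert e Q) ≤ p * w Q) (hp0 : 0 ≤ p)
    (F : Finset α) : (1 - p) ^ F.card ≤ gibbsProb E w {Q | Disjoint Q F} := by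
  classical
  have single : ∀ e, 1 - p ≤ gibbsProb E w {Q | e ∉ Q} := by
    intro e
    by_cases he : e ∈ E
    · rw [gibbsProb_eq, le_div_iff₀ hw.sum_pos]
      obtain ⟨E', he', rfl⟩ : ∃ E', e ∉ E' ∧ insert e E' = E :=
        ⟨E.erase e, Finset.notMem_erase _ _, Finset.insert_erase he⟩
      have hf : ∀ D : DecidablePred fun Q : Finset α => Q ∈ {Q : Finset α | e ∉ Q},
          @Finset.filter _ _ D (insert e E').powerset = E'.powerset := by
        intro D
        ext Q
        simp only [Finset.mem_filter, Finset.mem_powerset, Set.mem_ofPred_eq]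
        constructor
        · rintro ⟨h1, h2⟩
          exact (Finset.subset_insert_iff_of_notMem h2).1 h1
        · exact fun h => ⟨h.trans (Finset.subset_insert _ _), fun h' => he' (h h')⟩
      rw [hf, Finset.sum_powerset_insert he', mul_add]
      have : (1 - p) * ∑ t ∈ E'.powerset, w (insert e t) ≤ p * ∑ t ∈ E'.powerset, w t := by
        rw [Finset.mul_sum, Finset.mul_sum]
        refine Finset.sum_le_sum fun Q hQ => ?_
        have hQ := Finset.mem_powerset.1 hQ
        exact hins e he Q (hQ.trans (Finset.subset_insert _ _)) fun h => he' (hQ h)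
      linarith
    · have : gibbsProb E w Set.univ ≤ gibbsProb E w {Q | e ∉ Q} :=
        gibbsProb_mono hw.nonneg fun P hP _ h => he (hP h)
      rw [gibbsProb_univ hw.sum_pos.ne'] at this
      linarith
  have := hw.prod_le_iInter F (A := fun e => {Q | e ∉ Q}) fun e _ s t hts hs he => hs (hts he)
  calc (1 - p) ^ F.card = ∏ e ∈ F, (1 - p) := by simp
    _ ≤ ∏ e ∈ F, gibbsProb E w {Q | e ∉ Q} :=
        Finset.prod_le_prod (fun _ _ => by linarith) fun e _ => single e
    _ ≤ _ := this
    _ ≤ _ := gibbsProb_mono hw.nonneg fun P _ hP => by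
        simp only [Set.mem_iInter, Set.mem_ofPred_eq] at hP ⊢
        rw [Finset.disjoint_right]
        exact hP

end Gibbs

/-! ### Random-cluster measures with all vertices outside a finite set wired together -/

section Wired

variable {d : ℕ}

/-- The upper endpoint of an edge. -/
def tip (b : Edge d) : Vertex d := b.1 + Pi.single b.2 1

/-- The edges with at least one endpoint in `I`. -/
def touchingEdges (I : Finset (Vertex d)) : Finset (Edge d) :=
  (I ×ˢ Finset.univ) ∪ (I ×ˢ Finset.univ).image fun b => (b.1 - Pi.single b.2 1, b.2)

theorem mem_touchingEdges {I : Finset (Vertex d)} {b : Edge d} :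
    b ∈ touchingEdges I ↔ b.1 ∈ I ∨ tip b ∈ I := by
  unfold touchingEdges tip
  simp only [Finset.mem_union, Finset.mem_product, Finset.mem_univ, and_true, Finset.mem_image]
  refine or_congr Iff.rfl ⟨?_, fun h => ⟨(b.1 + Pi.single b.2 1, b.2), h, by simp⟩⟩
  rintro ⟨a, ha, rfl⟩
  simpa using ha

/-- The functions that vanish outside `I` and are constant on the clusters of `Q`. -/
def clusterFns (I : Finset (Vertex d)) (Q : Finset (Edge d)) : Submodule ℚ (Vertex d →₀ ℚ) where
  carrier := {h | (∀ x ∉ I, h x = 0) ∧ ∀ b ∈ Q, h b.1 = h (tip b)}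
  add_mem' := by
    rintro f g ⟨hf, hf'⟩ ⟨hg, hg'⟩
    exact ⟨fun x hx => by simp [hf x hx, hg x hx], fun b hb => by simp [hf' b hb, hg' b hb]⟩
  zero_mem' := by simp
  smul_mem' := by
    rintro c f ⟨hf, hf'⟩
    exact ⟨fun x hx => by simp [hf x hx], fun b hb => by simp [hf' b hb]⟩

theorem clusterFns_le_supported (I : Finset (Vertex d)) (Q : Finset (Edge d)) :
    clusterFns I Q ≤ Finsupp.supported ℚ ℚ (I : Set (Vertex d)) := by
  intro h hh
  rw [Finsupp.mem_supported']
  exact fun x hx => hh.1 x (by simpa using hx)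

theorem finiteDimensional_supported {K α : Type*} [Field K] (s : Set α) (hs : s.Finite) :
    FiniteDimensional K (Finsupp.supported K K s) := by
  have := hs.to_subtype
  exact Module.Finite.equiv (Finsupp.supportedEquivFinsupp (M := K) (R := K) s).symm

instance (I : Finset (Vertex d)) (Q : Finset (Edge d)) : FiniteDimensional ℚ (clusterFns I Q) :=
  have := finiteDimensional_supported (K := ℚ) (I : Set (Vertex d)) I.finite_toSet
  Submodule.finiteDimensional_of_le (clusterFns_le_supported I Q)

/-- The number of clusters of `Q` in `I` that are not connected to the outside of `I`. -/
def clusterRank (I : Finset (Vertex d)) (Q : Finset (Edge d)) : ℕ :=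
  Module.finrank ℚ (clusterFns I Q)

theorem clusterRank_anti (I : Finset (Vertex d)) {Q Q' : Finset (Edge d)} (h : Q ⊆ Q') :
    clusterRank I Q' ≤ clusterRank I Q :=
  Submodule.finrank_mono fun _ hf => ⟨hf.1, fun b hb => hf.2 b (h hb)⟩

/-- This is why clusters are counted by a dimension: the inequality is the formula dim(V + W) +
dim(V ∩ W) = dim V + dim W. The sum respects the edges common to Q and Q', and the intersection
respects the edges of both. -/
theorem clusterRank_add_le {I I' : Finset (Vertex d)} (hI : I ⊆ I') (Q Q' : Finset (Edge d)) :
    clusterRank I Q + clusterRank I' Q' ≤ clusterRank I' (Q ∩ Q') + clusterRank I (Q ∪ Q') := by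
  unfold clusterRank
  rw [← Submodule.finrank_sup_add_finrank_inf_eq]
  refine Nat.add_le_add (Submodule.finrank_mono (sup_le ?_ ?_)) (Submodule.finrank_mono ?_)
  · exact fun f hf => ⟨fun x hx => hf.1 x fun h => hx (hI h),
      fun b hb => hf.2 b (Finset.mem_inter.1 hb).1⟩
  · exact fun f hf => ⟨hf.1, fun b hb => hf.2 b (Finset.mem_inter.1 hb).2⟩
  · rintro f ⟨hf, hf'⟩
    exact ⟨hf.1, fun b hb => (Finset.mem_union.1 hb).elim (hf.2 b) (hf'.2 b)⟩

/-- An edge outside E has both endpoints outside I, where the functions vanish anyway, so it imposes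
no condition. -/
theorem clusterRank_inter {I : Finset (Vertex d)} {E : Finset (Edge d)}
    (hE : touchingEdges I ⊆ E) (Q : Finset (Edge d)) :
    clusterRank I (Q ∩ E) = clusterRank I Q := by
  unfold clusterRank
  have : clusterFns I (Q ∩ E) = clusterFns I Q := by
    ext h
    refine and_congr_right fun h0 => ⟨fun h1 b hb => ?_, fun h1 b hb => h1 b (Finset.mem_inter.1 hb).1⟩
    by_cases hbE : b ∈ E
    · exact h1 b (Finset.mem_inter.2 ⟨hb, hbE⟩)
    · have := fun h => hbE (hE (mem_touchingEdges.2 h))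
      rw [h0 _ fun h => this (Or.inl h), h0 _ fun h => this (Or.inr h)]
  rw [this]

/-- The random-cluster weight on the edge set `E` with the outside of `I` wired. -/
def wiredWeight (p q : ℝ) (I : Finset (Vertex d)) (E Q : Finset (Edge d)) : ℝ :=
  p ^ Q.card * (1 - p) ^ (E.card - Q.card) * q ^ clusterRank I Q

variable {p q : ℝ}

theorem wiredWeight_nonneg (hp0 : 0 ≤ p) (hp1 : p ≤ 1) (hq : 0 ≤ q) (I : Finset (Vertex d))
    (E Q : Finset (Edge d)) : 0 ≤ wiredWeight p q I E Q := by
  have : 0 ≤ 1 - p := by linarith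
  unfold wiredWeight
  positivity

theorem sum_wiredWeight_pos (hp0 : 0 ≤ p) (hp1 : p < 1) (hq : 0 < q) (I : Finset (Vertex d))
    (E : Finset (Edge d)) : 0 < ∑ Q ∈ E.powerset, wiredWeight p q I E Q := by
  refine Finset.sum_pos' (fun Q _ => wiredWeight_nonneg hp0 hp1.le hq.le I E Q)
    ⟨∅, by simp, ?_⟩
  have : 0 < 1 - p := by linarith
  unfold wiredWeight
  rw [Finset.card_empty, pow_zero]
  positivity

/-- With I = I' this is the FKG lattice condition; with I smaller than I' it is Holley's condition
for comparing the two wirings. -/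
theorem wiredWeight_mul_le (hp0 : 0 ≤ p) (hp1 : p ≤ 1) (hq : 1 ≤ q) {I I' : Finset (Vertex d)}
    (hI : I ⊆ I') {E s t : Finset (Edge d)} (hs : s ⊆ E) (ht : t ⊆ E) :
    wiredWeight p q I E s * wiredWeight p q I' E t
      ≤ wiredWeight p q I' E (s ∩ t) * wiredWeight p q I E (s ∪ t) := by
  have h1 : (s ∩ t).card + (s ∪ t).card = s.card + t.card := by
    rw [add_comm, Finset.card_union_add_card_inter]
  have h2 : (E.card - (s ∩ t).card) + (E.card - (s ∪ t).card)
      = (E.card - s.card) + (E.card - t.card) := by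
    have := Finset.card_le_card hs
    have := Finset.card_le_card ht
    have := Finset.card_le_card (Finset.union_subset hs ht)
    have := Finset.card_le_card ((Finset.inter_subset_left : s ∩ t ⊆ s).trans hs)
    omega
  have h3 := clusterRank_add_le hI s t
  have hp : 0 ≤ 1 - p := by linarith
  calc wiredWeight p q I E s * wiredWeight p q I' E t
      = p ^ (s.card + t.card) * (1 - p) ^ ((E.card - s.card) + (E.card - t.card))
        * q ^ (clusterRank I s + clusterRank I' t) := by
        unfold wiredWeight; ring
    _ ≤ p ^ (s.card + t.card) * (1 - p) ^ ((E.card - s.card) + (E.card - t.card))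
        * q ^ (clusterRank I' (s ∩ t) + clusterRank I (s ∪ t)) := by
        refine mul_le_mul_of_nonneg_left (pow_le_pow_right₀ hq h3) (by positivity)
    _ = _ := by
        rw [← h1, ← h2]; unfold wiredWeight; ring

theorem isFKGWeight_wiredWeight (hp0 : 0 ≤ p) (hp1 : p < 1) (hq : 1 ≤ q) (I : Finset (Vertex d))
    (E : Finset (Edge d)) : IsFKGWeight E (wiredWeight p q I E) where
  nonneg := wiredWeight_nonneg hp0 hp1.le (by linarith) I E
  sum_pos := sum_wiredWeight_pos hp0 hp1 (by linarith) I E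
  lattice _ hs _ ht := wiredWeight_mul_le hp0 hp1.le hq le_rfl hs ht

/-- The wired measure on a smaller set dominates. -/
theorem gibbsProb_wiredWeight_mono (hp0 : 0 ≤ p) (hp1 : p < 1) (hq : 1 ≤ q)
    {I I' : Finset (Vertex d)} (hI : I ⊆ I') (E : Finset (Edge d)) {A : Set (Finset (Edge d))}
    (hA : IsLowerSet A) :
    gibbsProb E (wiredWeight p q I E) A ≤ gibbsProb E (wiredWeight p q I' E) A :=
  gibbsProb_le_of_holley (isFKGWeight_wiredWeight hp0 hp1 hq I E).nonneg
    (isFKGWeight_wiredWeight hp0 hp1 hq I' E).nonneg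
    (isFKGWeight_wiredWeight hp0 hp1 hq I E).sum_pos
    (isFKGWeight_wiredWeight hp0 hp1 hq I' E).sum_pos
    (fun _ hs _ ht => wiredWeight_mul_le hp0 hp1.le hq hI hs ht) hA

/-- Edges that do not touch I do not affect the cluster count, so they are independent of the others
and can be summed out with total weight (p + (1 - p))^n = 1. -/
theorem gibbsProb_wiredWeight_restrict {I : Finset (Vertex d)} {E E' : Finset (Edge d)}
    (hI : touchingEdges I ⊆ E) (hE : E ⊆ E') (A : Set (Finset (Edge d))) :
    gibbsProb E' (wiredWeight p q I E') {Q | Q ∩ E ∈ A} = gibbsProb E (wiredWeight p q I E) A := by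
  refine gibbsProb_restrict hE
    (v := fun P => p ^ P.card * (1 - p) ^ ((E' \ E).card - P.card)) ?_ ?_ A
  · rw [Finset.sum_pow_mul_eq_add_pow]
    simp
  · intro P hP
    unfold wiredWeight
    rw [clusterRank_inter hI]
    have h1 : P.card = (P ∩ E).card + (P \ E).card := (Finset.card_inter_add_card_sdiff P E).symm
    have h2 : E'.card = E.card + (E' \ E).card := by
      rw [← Finset.card_inter_add_card_sdiff E' E, Finset.inter_eq_right.2 hE]
    have h3 := Finset.card_le_card (Finset.inter_subset_right : P ∩ E ⊆ E)
    have h4 := Finset.card_le_card (Finset.sdiff_subset_sdiff hP le_rfl : P \ E ⊆ E' \ E)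
    have h5 : E'.card - P.card = (E.card - (P ∩ E).card) + ((E' \ E).card - (P \ E).card) := by
      omega
    rw [h5, pow_add, h1, pow_add]
    ring

theorem pow_le_gibbsProb_disjoint (hp0 : 0 ≤ p) (hp1 : p < 1) (hq : 1 ≤ q)
    (I : Finset (Vertex d)) (E F : Finset (Edge d)) :
    (1 - p) ^ F.card ≤ gibbsProb E (wiredWeight p q I E) {Q | Disjoint Q F} := by
  refine (isFKGWeight_wiredWeight hp0 hp1 hq I E).pow_le_disjoint hp1.le ?_ hp0 F
  intro e he Q hQ heQ
  have hp : 0 ≤ 1 - p := by linarith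
  have h1 : (insert e Q).card = Q.card + 1 := Finset.card_insert_of_notMem heQ
  have h2 := Finset.card_le_card (Finset.insert_subset he hQ)
  have h3 : E.card - Q.card = (E.card - (insert e Q).card) + 1 := by omega
  unfold wiredWeight
  rw [h3, h1]
  calc (1 - p) * (p ^ (Q.card + 1) * (1 - p) ^ (E.card - (Q.card + 1))
          * q ^ clusterRank I (insert e Q))
      = p ^ (Q.card + 1) * (1 - p) ^ (E.card - (Q.card + 1) + 1)
          * q ^ clusterRank I (insert e Q) := by ring
    _ ≤ p ^ (Q.card + 1) * (1 - p) ^ (E.card - (Q.card + 1) + 1) * q ^ clusterRank I Q := by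
        refine mul_le_mul_of_nonneg_left
          (pow_le_pow_right₀ hq (clusterRank_anti I (Finset.subset_insert _ _))) (by positivity)
    _ = _ := by ring

/-! ### Interfaces -/

/-- The event that there is a set of vertices, equal to the half-space `{x_e ≥ 0}` outside `I`,
that no edge of `Q` leaves. -/
def separated (e : Fin d) (I : Finset (Vertex d)) : Set (Finset (Edge d)) :=
  {Q | ∃ U : Set (Vertex d), (∀ x ∉ I, x ∈ U ↔ 0 ≤ x e) ∧ ∀ b ∈ Q, b.1 ∈ U ↔ tip b ∈ U}

theorem isLowerSet_separated (e : Fin d) (I : Finset (Vertex d)) :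
    IsLowerSet (separated e I) := by
  rintro Q Q' h ⟨U, h1, h2⟩
  exact ⟨U, h1, fun b hb => h2 b (h hb)⟩

/-- The probability that there is an interface in `I`. -/
def sepProb (p q : ℝ) (e : Fin d) (I : Finset (Vertex d)) (E : Finset (Edge d)) : ℝ :=
  gibbsProb E (wiredWeight p q I E) (separated e I)

/-- Interfaces in pairwise non-adjacent sets `J t` can be glued together along the hyperplane. -/
theorem prod_sepProb_mul_le (hp0 : 0 ≤ p) (hp1 : p < 1) (hq : 1 ≤ q) (e : Fin d)
    {I : Finset (Vertex d)} {E : Finset (Edge d)} {ι : Type*} (T : Finset ι)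
    {J : ι → Finset (Vertex d)} {D : ι → Finset (Edge d)}
    (hJ : ∀ t ∈ T, J t ⊆ I) (hJD : ∀ t ∈ T, touchingEdges (J t) ⊆ D t) (hD : ∀ t ∈ T, D t ⊆ E)
    (hsep : ∀ t ∈ T, ∀ s ∈ T, t ≠ s → Disjoint (touchingEdges (J t)) (touchingEdges (J s)))
    {F : Finset (Edge d)}
    (hF : ∀ b ∈ E, b.2 = e → b.1 e = -1 → (∀ t ∈ T, b ∉ touchingEdges (J t)) → b ∈ F) :
    (∏ t ∈ T, sepProb p q e (J t) (D t)) * (1 - p) ^ F.card ≤ sepProb p q e I E := by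
  classical
  have hw := isFKGWeight_wiredWeight hp0 hp1 hq I E
  have hlow : ∀ t, IsLowerSet {Q | Q ∩ D t ∈ separated e (J t)} := fun t Q Q' h hQ =>
    isLowerSet_separated e (J t) (Finset.inter_subset_inter_right h) hQ
  have h1 : ∏ t ∈ T, sepProb p q e (J t) (D t)
      ≤ gibbsProb E (wiredWeight p q I E) (⋂ t ∈ T, {Q | Q ∩ D t ∈ separated e (J t)}) := by
    refine (Finset.prod_le_prod (fun t ht => ?_) fun t ht => ?_).trans
      (hw.prod_le_iInter T fun t _ => hlow t)
    · exact gibbsProb_nonneg (isFKGWeight_wiredWeight hp0 hp1 hq _ _).nonneg _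
    · unfold sepProb
      rw [← gibbsProb_wiredWeight_restrict (hJD t ht) (hD t ht)]
      exact gibbsProb_wiredWeight_mono hp0 hp1 hq (hJ t ht) E (hlow t)
  refine (mul_le_mul h1 (pow_le_gibbsProb_disjoint hp0 hp1 hq I E F)
    (pow_nonneg (by linarith) _) (gibbsProb_nonneg hw.nonneg _)).trans ?_
  refine (hw.mul_le_inter (isLowerSet_iInter₂ fun t _ => hlow t) (isLowerSet_disjoint F)).trans ?_
  refine gibbsProb_mono hw.nonneg ?_
  rintro Q hQE ⟨hQ, hQF⟩
  simp only [Set.mem_iInter, Set.mem_ofPred_eq] at hQ hQF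
  have hQ' : ∀ t, ∃ U : Set (Vertex d), t ∈ T → (∀ x ∉ J t, x ∈ U ↔ 0 ≤ x e) ∧
      ∀ b ∈ Q ∩ D t, b.1 ∈ U ↔ tip b ∈ U := by
    intro t
    by_cases ht : t ∈ T
    · obtain ⟨U, hU⟩ := hQ t ht
      exact ⟨U, fun _ => hU⟩
    · exact ⟨∅, fun h => absurd h ht⟩
  choose U hU using hQ'
  have hdisj : ∀ t ∈ T, ∀ s ∈ T, ∀ b ∈ touchingEdges (J t), b ∈ touchingEdges (J s) → t = s := by
    intro t ht s hs b hbt hbs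
    by_contra hts
    exact Finset.disjoint_left.1 (hsep t ht s hs hts) hbt hbs
  -- The glued interface follows `U t` inside each tile and the half-space elsewhere.
  refine ⟨{x | (∃ t ∈ T, x ∈ J t ∧ x ∈ U t) ∨ (∀ t ∈ T, x ∉ J t) ∧ 0 ≤ x e}, ?_, ?_⟩
  · intro x hx
    have hx' : ∀ t ∈ T, x ∉ J t := fun t ht h => hx (hJ t ht h)
    simp only [Set.mem_ofPred_eq]
    constructor
    · rintro (⟨t, ht, h, -⟩ | h)
      · exact absurd h (hx' t ht)
      · exact h.2
    · exact fun h => Or.inr ⟨hx', h⟩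
  · intro b hb
    -- An edge touching `J t` touches no other tile, so at both of its ends the glued set agrees
    -- with `U t`.
    have key : ∀ t ∈ T, b ∈ touchingEdges (J t) → ∀ x, (x = b.1 ∨ x = tip b) →
        (((∃ t ∈ T, x ∈ J t ∧ x ∈ U t) ∨ (∀ t ∈ T, x ∉ J t) ∧ 0 ≤ x e) ↔ x ∈ U t) := by
      intro t ht hbt x hx
      have hxt : ∀ s ∈ T, x ∈ J s → s = t := by
        intro s hs hxs
        refine hdisj s hs t ht b (mem_touchingEdges.2 ?_) hbt
        rcases hx with rfl | rfl
        · exact Or.inl hxs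
        · exact Or.inr hxs
      by_cases hxJ : x ∈ J t
      · constructor
        · rintro (⟨s, hs, h1, h2⟩ | h)
          · rwa [hxt s hs h1] at h2
          · exact absurd hxJ (h.1 t ht)
        · exact fun h => Or.inl ⟨t, ht, hxJ, h⟩
      · rw [(hU t ht).1 x hxJ]
        constructor
        · rintro (⟨s, hs, h1, h2⟩ | h)
          · exact absurd (hxt s hs h1 ▸ h1) hxJ
          · exact h.2
        · exact fun h => Or.inr ⟨fun s hs h' => hxJ (hxt s hs h' ▸ h'), h⟩
    simp only [Set.mem_ofPred_eq]
    by_cases hbT : ∃ t ∈ T, b ∈ touchingEdges (J t)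
    · obtain ⟨t, ht, hbt⟩ := hbT
      rw [key t ht hbt _ (Or.inl rfl), key t ht hbt _ (Or.inr rfl)]
      exact (hU t ht).2 b (Finset.mem_inter.2 ⟨hb, hJD t ht hbt⟩)
    · push Not at hbT
      have hn : ∀ t ∈ T, b.1 ∉ J t ∧ tip b ∉ J t := fun t ht => by
        have := hbT t ht
        rw [mem_touchingEdges] at this
        tauto
      have h0 : 0 ≤ b.1 e ↔ 0 ≤ tip b e := by
        by_cases hbe : b.2 = e
        · have h1 : b.1 e ≠ -1 := fun h =>
            Finset.disjoint_left.1 hQF hb (hF b (hQE hb) hbe h hbT)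
          simp only [tip, hbe, Pi.add_apply, Pi.single_eq_same]
          omega
        · simp [tip, Pi.single_eq_of_ne' hbe]
      constructor
      · rintro (⟨t, ht, h, -⟩ | h)
        · exact absurd h (hn t ht).1
        · exact Or.inr ⟨fun t ht => (hn t ht).2, h0.1 h.2⟩
      · rintro (⟨t, ht, h, -⟩ | h)
        · exact absurd h (hn t ht).2
        · exact Or.inr ⟨fun t ht => (hn t ht).1, h0.2 h.2⟩

end Wired

/-! ### Translations -/

section Shift

variable {d : ℕ}

/-- The translate of a set of vertices. -/
def shift (v : Vertex d) (I : Finset (Vertex d)) : Finset (Vertex d) := I.image (· + v)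

/-- The translate of a set of edges. -/
def shiftEdges (v : Vertex d) (Q : Finset (Edge d)) : Finset (Edge d) :=
  Q.image fun b => (b.1 + v, b.2)

theorem mem_shift {v : Vertex d} {I : Finset (Vertex d)} {x : Vertex d} :
    x ∈ shift v I ↔ x - v ∈ I := by
  unfold shift
  rw [Finset.mem_image]
  exact ⟨by rintro ⟨a, ha, rfl⟩; simpa using ha, fun h => ⟨_, h, by simp⟩⟩

theorem mem_shiftEdges {v : Vertex d} {Q : Finset (Edge d)} {b : Edge d} :
    b ∈ shiftEdges v Q ↔ (b.1 - v, b.2) ∈ Q := by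
  unfold shiftEdges
  rw [Finset.mem_image]
  exact ⟨by rintro ⟨a, ha, rfl⟩; simpa using ha, fun h => ⟨_, h, by simp⟩⟩

theorem tip_sub (b : Edge d) (v : Vertex d) : tip (b.1 - v, b.2) = tip b - v := by
  simp only [tip]; abel

theorem card_shiftEdges (v : Vertex d) (Q : Finset (Edge d)) : (shiftEdges v Q).card = Q.card :=
  Finset.card_image_of_injective _ fun a b h => by
    simpa [Prod.ext_iff] using h

theorem shiftEdges_neg_shiftEdges (v : Vertex d) (Q : Finset (Edge d)) :
    shiftEdges (-v) (shiftEdges v Q) = Q := by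
  ext b; simp [mem_shiftEdges]

theorem shiftEdges_shiftEdges_neg (v : Vertex d) (Q : Finset (Edge d)) :
    shiftEdges v (shiftEdges (-v) Q) = Q := by
  ext b; simp [mem_shiftEdges]

theorem shiftEdges_mono (v : Vertex d) {Q Q' : Finset (Edge d)} (h : Q ⊆ Q') :
    shiftEdges v Q ⊆ shiftEdges v Q' := Finset.image_subset_image h

theorem touchingEdges_shift (v : Vertex d) (I : Finset (Vertex d)) :
    touchingEdges (shift v I) = shiftEdges v (touchingEdges I) := by
  ext b
  simp only [mem_touchingEdges, mem_shiftEdges, mem_shift, tip_sub]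

theorem clusterRank_shift (v : Vertex d) (I : Finset (Vertex d)) (Q : Finset (Edge d)) :
    clusterRank (shift v I) (shiftEdges v Q) = clusterRank I Q := by
  unfold clusterRank
  let φ : (Vertex d →₀ ℚ) ≃ₗ[ℚ] (Vertex d →₀ ℚ) := Finsupp.domLCongr (Equiv.addRight v)
  have hφ : ∀ f x, φ f x = f (x - v) := by
    intro f x
    simp [φ, Finsupp.domLCongr, sub_eq_add_neg]
  have : clusterFns (shift v I) (shiftEdges v Q) = (clusterFns I Q).map φ.toLinearMap := by
    ext h
    rw [Submodule.mem_map]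
    constructor
    · rintro ⟨h1, h2⟩
      refine ⟨φ.symm h, ?_, by simp⟩
      have hs : ∀ x, φ.symm h x = h (x + v) := by
        intro x
        have := hφ (φ.symm h) (x + v)
        simpa using this.symm
      refine ⟨fun x hx => ?_, fun b hb => ?_⟩
      · rw [hs]
        exact h1 _ (by simpa [mem_shift] using hx)
      · rw [hs, hs]
        have := h2 (b.1 + v, b.2) (by simpa [mem_shiftEdges] using hb)
        rw [this]
        congr 1
        simp only [tip]; abel
    · rintro ⟨f, ⟨h1, h2⟩, rfl⟩
      refine ⟨fun x hx => ?_, fun b hb => ?_⟩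
      · rw [LinearEquiv.coe_coe, hφ]
        exact h1 _ fun h => hx (mem_shift.2 h)
      · rw [LinearEquiv.coe_coe, hφ, hφ, ← tip_sub]
        exact h2 _ (mem_shiftEdges.1 hb)
  rw [this]
  exact LinearEquiv.finrank_map_eq φ _

theorem shiftEdges_mem_separated {e : Fin d} {v : Vertex d} (hv : v e = 0)
    {I : Finset (Vertex d)} {Q : Finset (Edge d)} (hQ : Q ∈ separated e I) :
    shiftEdges v Q ∈ separated e (shift v I) := by
  obtain ⟨U, h1, h2⟩ := hQ
  refine ⟨{x | x - v ∈ U}, fun x hx => ?_, fun b hb => ?_⟩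
  · have := h1 (x - v) fun h => hx (mem_shift.2 h)
    simpa [hv] using this
  · have := h2 _ (mem_shiftEdges.1 hb)
    rwa [tip_sub] at this

/-- Only translations along the hyperplane are allowed, since the half-space that prescribes the
interface outside I must be preserved. -/
theorem sepProb_shift (p q : ℝ) {e : Fin d} {v : Vertex d} (hv : v e = 0)
    (I : Finset (Vertex d)) :
    sepProb p q e (shift v I) (touchingEdges (shift v I))
      = sepProb p q e I (touchingEdges I) := by
  symm
  unfold sepProb
  rw [touchingEdges_shift]
  refine gibbsProb_congr one_ne_zero (shiftEdges v) (shiftEdges (-v))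
    (fun P hP => shiftEdges_mono v hP) (fun P hP => ?_)
    (fun P _ => shiftEdges_neg_shiftEdges v P) (fun P _ => shiftEdges_shiftEdges_neg v P)
    (fun P hP => ?_) fun P hP => ⟨shiftEdges_mem_separated hv, fun h => ?_⟩
  · simpa [shiftEdges_neg_shiftEdges] using shiftEdges_mono (-v) hP
  · unfold wiredWeight
    rw [card_shiftEdges, card_shiftEdges, clusterRank_shift, one_mul]
  · have := shiftEdges_mem_separated (v := -v) (by simp [hv]) h
    have hI : shift (-v) (shift v I) = I := by ext x; simp [mem_shift]
    rwa [shiftEdges_neg_shiftEdges, hI] at this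

end Shift

/-! ### Boxes -/

section Boxes

variable {d : ℕ}

/-- The lattice points of `[a, b]^d`. -/
def box (d : ℕ) (a b : ℤ) : Finset (Vertex d) := Finset.Icc (fun _ => a) (fun _ => b)

theorem mem_box {a b : ℤ} {x : Vertex d} : x ∈ box d a b ↔ ∀ m, a ≤ x m ∧ x m ≤ b := by
  simp only [box, Finset.mem_Icc, Pi.le_def, forall_and]

/-- The points of `I` in the hyperplane `{x_e = 0}`. -/
def crossSection (e : Fin d) (I : Finset (Vertex d)) : Finset (Vertex d) :=
  I.filter fun x => x e = 0

theorem mem_crossSection {e : Fin d} {I : Finset (Vertex d)} {x : Vertex d} :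
    x ∈ crossSection e I ↔ x ∈ I ∧ x e = 0 := Finset.mem_filter

theorem card_crossSection_box (e : Fin d) {a b : ℤ} (ha : a ≤ 0) (hb : 0 ≤ b) :
    (crossSection e (box d a b)).card = (b + 1 - a).toNat ^ (d - 1) := by
  have : crossSection e (box d a b)
      = Fintype.piFinset fun i => if i = e then ({0} : Finset ℤ) else Finset.Icc a b := by
    ext x
    simp only [mem_crossSection, mem_box, Fintype.mem_piFinset]
    constructor
    · rintro ⟨h1, h2⟩ i
      by_cases hi : i = e
      · subst hi; simpa using h2
      · simpa [hi] using h1 i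
    · intro h
      have he : x e = 0 := by simpa using h e
      refine ⟨fun i => ?_, he⟩
      by_cases hi : i = e
      · subst hi; rw [he]; exact ⟨ha, hb⟩
      · simpa [hi] using h i
  rw [this, Fintype.card_piFinset, ← Finset.mul_prod_erase _ _ (Finset.mem_univ e)]
  rw [Finset.prod_congr rfl (g := fun _ => (b + 1 - a).toNat)]
  · simp
  · intro i hi
    simp [Finset.ne_of_mem_erase hi]

theorem card_crossSection_shift (e : Fin d) {v : Vertex d} (hv : v e = 0)
    (I : Finset (Vertex d)) : (crossSection e (shift v I)).card = (crossSection e I).card := by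
  symm
  refine Finset.card_nbij' (· + v) (· - v) ?_ ?_ ?_ ?_ <;> intro x <;>
    simp +contextual [mem_crossSection, mem_shift, hv]

variable {p q : ℝ}

/-- Interfaces in non-adjacent sets can be glued together at a cost that is exponential in the
uncovered part of the hyperplane. -/
theorem prod_sepProb_mul_pow_card_le (hp0 : 0 ≤ p) (hp1 : p < 1) (hq : 1 ≤ q) (e : Fin d)
    {I B : Finset (Vertex d)} {E : Finset (Edge d)} {ι : Type*} (T : Finset ι)
    {J : ι → Finset (Vertex d)} {D : ι → Finset (Edge d)}
    (hJ : ∀ t ∈ T, J t ⊆ I) (hJD : ∀ t ∈ T, touchingEdges (J t) ⊆ D t) (hD : ∀ t ∈ T, D t ⊆ E)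
    (hsep : ∀ t ∈ T, ∀ s ∈ T, t ≠ s → Disjoint (touchingEdges (J t)) (touchingEdges (J s)))
    (hB : ∀ b ∈ E, b.2 = e → b.1 e = -1 → tip b ∈ B)
    (hJB : ∀ t ∈ T, crossSection e (J t) ⊆ B) :
    (∏ t ∈ T, sepProb p q e (J t) (D t)) *
        (1 - p) ^ (B.card - ∑ t ∈ T, (crossSection e (J t)).card) ≤ sepProb p q e I E := by
  classical
  set C := T.biUnion fun t => crossSection e (J t) with hC
  have hCcard : C.card = ∑ t ∈ T, (crossSection e (J t)).card := by
    refine Finset.card_biUnion fun t ht s hs hts => ?_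
    refine Finset.disjoint_left.2 fun x hxt hxs => ?_
    refine Finset.disjoint_left.1 (hsep t ht s hs hts) (?_ : (x, e) ∈ _) ?_
    · exact mem_touchingEdges.2 (Or.inl (mem_crossSection.1 hxt).1)
    · exact mem_touchingEdges.2 (Or.inl (mem_crossSection.1 hxs).1)
  have hCB : C ⊆ B := Finset.biUnion_subset.2 hJB
  -- One edge for each uncovered point of B: the vertical edge that arrives there from height -1.
  set F : Finset (Edge d) := (B \ C).image fun x => (x - Pi.single e 1, e) with hF
  have hFcard : F.card ≤ B.card - ∑ t ∈ T, (crossSection e (J t)).card := by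
    rw [← hCcard, ← Finset.card_sdiff_of_subset hCB]
    exact Finset.card_image_le
  refine le_trans ?_ (prod_sepProb_mul_le hp0 hp1 hq e T hJ hJD hD hsep (F := F) ?_)
  · refine mul_le_mul_of_nonneg_left ?_ (Finset.prod_nonneg fun t _ =>
      gibbsProb_nonneg (isFKGWeight_wiredWeight hp0 hp1 hq _ _).nonneg _)
    exact pow_le_pow_of_le_one (by linarith) (by linarith) hFcard
  · rintro ⟨x, j⟩ hb (rfl : j = e) hbe hn
    refine Finset.mem_image.2 ⟨tip (x, j), ?_, by simp [tip]⟩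
    refine Finset.mem_sdiff.2 ⟨hB _ hb rfl hbe, fun h => ?_⟩
    obtain ⟨t, ht, h⟩ := Finset.mem_biUnion.1 h
    exact hn t ht (mem_touchingEdges.2 (Or.inr (mem_crossSection.1 h).1))

/-- The special case of a single tile. -/
theorem sepProb_mul_pow_card_le (hp0 : 0 ≤ p) (hp1 : p < 1) (hq : 1 ≤ q) (e : Fin d)
    {I B J : Finset (Vertex d)} {E D : Finset (Edge d)}
    (hJ : J ⊆ I) (hJD : touchingEdges J ⊆ D) (hD : D ⊆ E)
    (hB : ∀ b ∈ E, b.2 = e → b.1 e = -1 → tip b ∈ B) (hJB : crossSection e J ⊆ B) :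
    sepProb p q e J D * (1 - p) ^ (B.card - (crossSection e J).card) ≤ sepProb p q e I E := by
  have := prod_sepProb_mul_pow_card_le hp0 hp1 hq e (T := Finset.univ (α := Unit))
    (J := fun _ => J) (D := fun _ => D) (fun _ _ => hJ) (fun _ _ => hJD) (fun _ _ => hD)
    (fun t _ s _ h => absurd (Subsingleton.elim t s) h) hB (fun _ _ => hJB)
  simpa using this

theorem tip_mem_crossSection {e : Fin d} {a c : ℤ} (ha : a ≤ 0) (hc : 0 ≤ c) {b : Edge d}
    (hb : b ∈ touchingEdges (box d a c)) (hbe : b.2 = e) (hb1 : b.1 e = -1) :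
    tip b ∈ crossSection e (box d a c) := by
  subst hbe
  have h0 : tip b b.2 = 0 := by simp [tip, hb1]
  refine mem_crossSection.2 ⟨mem_box.2 fun m => ?_, h0⟩
  by_cases hm : m = b.2
  · subst hm; rw [h0]; exact ⟨ha, hc⟩
  · have : tip b m = b.1 m := by simp [tip, hm]
    rcases mem_touchingEdges.1 hb with h | h
    · rw [this]; exact mem_box.1 h m
    · exact mem_box.1 h m

/-- The probability of an interface in the cube `[-N + 1, N - 1]^d`. -/
def cubeSepProb (d : ℕ) (e : Fin d) (p q : ℝ) (N : ℕ) : ℝ :=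
  sepProb p q e (box d (1 - N) (N - 1)) (touchingEdges (box d (1 - N) (N - 1)))

/-- Approximate subadditivity: a cube contains `(N / n)^(d-1)` non-adjacent translates of a smaller
cube, centred on the hyperplane. -/
theorem cubeSepProb_pow_mul_le (hp0 : 0 ≤ p) (hp1 : p < 1) (hq : 1 ≤ q) (e : Fin d) {n N : ℕ}
    (hn : 1 ≤ n) (hN : n ≤ N) :
    cubeSepProb d e p q n ^ ((N / n) ^ (d - 1)) *
        (1 - p) ^ ((2 * N - 1) ^ (d - 1) - (N / n * (2 * n - 1)) ^ (d - 1))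
      ≤ cubeSepProb d e p q N := by
  classical
  set k := N / n with hk
  have hkn : k * n ≤ N := Nat.div_mul_le_self N n
  -- The coordinate e of an index is frozen at 0, which leaves k^(d-1) tiles.
  let T : Finset (Fin d → ℕ) := Fintype.piFinset fun i => if i = e then {0} else Finset.range k
  -- The offset n - N puts the first tile at 1 - N, flush with the large cube. A tile has 2n - 1
  -- points per side, so period 2n leaves a one-point gap between neighbours.
  let V : (Fin d → ℕ) → Vertex d := fun t i => if i = e then 0 else n - N + 2 * n * t i
  have hT : ∀ t ∈ T, ∀ i, i ≠ e → t i < k := by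
    intro t ht i hi
    have := Fintype.mem_piFinset.1 ht i
    simpa [hi] using this
  have hTe : ∀ t ∈ T, t e = 0 := by
    intro t ht
    simpa using Fintype.mem_piFinset.1 ht e
  have hV : ∀ t, V t e = 0 := fun t => by simp [V]
  have hTcard : T.card = k ^ (d - 1) := by
    rw [Fintype.card_piFinset, ← Finset.mul_prod_erase _ _ (Finset.mem_univ e)]
    rw [Finset.prod_congr rfl (g := fun _ => k)]
    · simp
    · intro i hi
      simp [Finset.ne_of_mem_erase hi]
  have hJ : ∀ t ∈ T, shift (V t) (box d (1 - n) (n - 1)) ⊆ box d (1 - N) (N - 1) := by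
    intro t ht x hx
    rw [mem_shift, mem_box] at hx
    refine mem_box.2 fun m => ?_
    have h := hx m
    rw [Pi.sub_apply] at h
    by_cases hm : m = e
    · subst hm
      rw [hV] at h
      omega
    · have h2 : t m + 1 ≤ k := hT t ht m hm
      have h3 : (t m + 1) * n ≤ N := (Nat.mul_le_mul_right n h2).trans hkn
      have h4 : V t m = n - N + 2 * n * t m := by simp [V, hm]
      rw [h4] at h
      have h5 : ((t m : ℤ) + 1) * n ≤ N := by exact_mod_cast h3
      have h6 : (0 : ℤ) ≤ n * t m := by positivity
      constructor <;> nlinarith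
  have key := prod_sepProb_mul_pow_card_le hp0 hp1 hq e
    (B := crossSection e (box d (1 - N) (N - 1)))
    (E := touchingEdges (box d (1 - N) (N - 1))) T
    (D := fun t => touchingEdges (shift (V t) (box d (1 - n) (n - 1)))) hJ
    (fun t _ => le_rfl)
    (fun t ht b hb => mem_touchingEdges.2
      ((mem_touchingEdges.1 hb).imp (fun h => hJ t ht h) fun h => hJ t ht h))
    ?_ (fun b hb => tip_mem_crossSection (by omega) (by omega) hb)
    (fun t ht x hx => mem_crossSection.2
      ⟨hJ t ht (mem_crossSection.1 hx).1, (mem_crossSection.1 hx).2⟩)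
  · unfold cubeSepProb
    rw [card_crossSection_box e (by omega) (by omega), Finset.prod_congr rfl fun t _ =>
      sepProb_shift p q (hV t) _, Finset.prod_const, hTcard, Finset.sum_congr rfl fun t _ =>
      card_crossSection_shift e (hV t) _, Finset.sum_const, hTcard,
      card_crossSection_box e (by omega) (by omega), smul_eq_mul, ← mul_pow] at key
    convert key using 5
    · omega
    · congr 1; omega
  · intro t ht s hs hts
    obtain ⟨i, hi⟩ : ∃ i, t i ≠ s i := by
      by_contra! h
      exact hts (funext h)
    have hie : i ≠ e := by
      rintro rfl
      exact hi ((hTe t ht).trans (hTe s hs).symm)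
    rw [Finset.disjoint_left]
    intro b hbt hbs
    have hV' : ∀ t, V t i = n - N + 2 * n * t i := fun t => by simp [V, hie]
    have htip : tip b i = b.1 i ∨ tip b i = b.1 i + 1 := by
      by_cases h : i = b.2
      · subst h; right; simp [tip]
      · left; simp [tip, h]
    -- The lower endpoints of the edges touching a tile have i-th coordinates in a window of 2n
    -- integers, and windows shifted by distinct multiples of 2n are disjoint.
    have h1 : ∀ t, b ∈ touchingEdges (shift (V t) (box d (1 - n) (n - 1))) →
        1 - n ≤ b.1 i + 1 - V t i ∧ b.1 i - V t i ≤ n - 1 := by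
      intro t hb
      rcases mem_touchingEdges.1 hb with h | h
      · have := mem_box.1 (mem_shift.1 h) i
        rw [Pi.sub_apply] at this
        omega
      · have := mem_box.1 (mem_shift.1 h) i
        rw [Pi.sub_apply] at this
        omega
    have ht1 := h1 t hbt
    have hs1 := h1 s hbs
    rw [hV'] at ht1 hs1
    rcases lt_or_gt_of_ne hi with h | h
    · have h : (t i : ℤ) + 1 ≤ s i := by exact_mod_cast h
      have : (n : ℤ) * (t i + 1) ≤ n * s i := mul_le_mul_of_nonneg_left h (by positivity)
      linarith
    · have h : (s i : ℤ) + 1 ≤ t i := by exact_mod_cast h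
      have : (n : ℤ) * (s i + 1) ≤ n * t i := mul_le_mul_of_nonneg_left h (by positivity)
      linarith

/-! ### Comparison of cubes with dual boxes -/

/-- The edges with both endpoints in `[-N, N - 1]^d`. -/
def dualBoxEdges (d N : ℕ) : Finset (Edge d) :=
  (box d (-N) (N - 1) ×ˢ Finset.univ).filter fun b => tip b ∈ box d (-N) (N - 1)

theorem mem_dualBoxEdges {N : ℕ} {b : Edge d} :
    b ∈ dualBoxEdges d N ↔ b.1 ∈ box d (-N) (N - 1) ∧ tip b ∈ box d (-N) (N - 1) := by
  simp [dualBoxEdges]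

theorem tip_apply (b : Edge d) (m : Fin d) :
    tip b m = b.1 m ∨ tip b m = b.1 m + 1 := by
  by_cases h : m = b.2
  · subst h; right; simp [tip]
  · left; simp [tip, h]

theorem box_subset_box {a b a' b' : ℤ} (ha : a' ≤ a) (hb : b ≤ b') :
    box d a b ⊆ box d a' b' := fun x hx => mem_box.2 fun m => by
  have := mem_box.1 hx m
  omega

theorem touchingEdges_mono {I J : Finset (Vertex d)} (h : I ⊆ J) :
    touchingEdges I ⊆ touchingEdges J := fun _ hb =>
  mem_touchingEdges.2 ((mem_touchingEdges.1 hb).imp (fun h' => h h') fun h' => h h')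

theorem touchingEdges_subset_dualBoxEdges (N : ℕ) :
    touchingEdges (box d (1 - N) (N - 2)) ⊆ dualBoxEdges d N := by
  intro b hb
  have : ∀ m, 1 - (N : ℤ) - 1 ≤ b.1 m ∧ b.1 m ≤ N - 2 + 1 ∧ 1 - (N : ℤ) - 1 ≤ tip b m ∧
      tip b m ≤ N - 2 + 1 := by
    intro m
    have h1 := tip_apply b m
    rcases mem_touchingEdges.1 hb with h | h
    · have := mem_box.1 h m
      omega
    · have := mem_box.1 h m
      omega
  refine mem_dualBoxEdges.2 ⟨mem_box.2 fun m => ?_, mem_box.2 fun m => ?_⟩ <;>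
    · have := this m
      omega

/-- The probability of an interface in the dual box `[-N, N - 1]^d`, with wired boundary and all
edges of the box random. -/
def dualBoxSepProb (d : ℕ) (e : Fin d) (p q : ℝ) (N : ℕ) : ℝ :=
  sepProb p q e (box d (1 - N) (N - 2)) (dualBoxEdges d N)

/-- The cube is a single tile in the interior [-N, N-1]^d of the dual box of size N + 1. All edges
of that dual box are random, so the uncovered part is counted in its full cross-section, with side
2N + 2. -/
theorem cubeSepProb_mul_le_dualBoxSepProb (hp0 : 0 ≤ p) (hp1 : p < 1) (hq : 1 ≤ q) (e : Fin d)
    {N : ℕ} (hN : 1 ≤ N) :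
    cubeSepProb d e p q N * (1 - p) ^ ((2 * N + 2) ^ (d - 1) - (2 * N - 1) ^ (d - 1))
      ≤ dualBoxSepProb d e p q (N + 1) := by
  have hJ : box d (1 - N) (N - 1) ⊆ box d (1 - (N + 1 : ℕ)) ((N + 1 : ℕ) - 2) :=
    box_subset_box (by omega) (by omega)
  have key := sepProb_mul_pow_card_le hp0 hp1 hq e (E := dualBoxEdges d (N + 1))
    (B := crossSection e (box d (-(N + 1 : ℕ)) ((N + 1 : ℕ) - 1))) hJ le_rfl
    ((touchingEdges_mono hJ).trans (touchingEdges_subset_dualBoxEdges (N + 1))) ?_ ?_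
  · rw [card_crossSection_box e (by omega) (by omega),
      card_crossSection_box e (by omega) (by omega),
      show ((N + 1 : ℕ) - 1 + 1 - -((N + 1 : ℕ) : ℤ)).toNat = 2 * N + 2 by omega,
      show ((N : ℤ) - 1 + 1 - (1 - N)).toNat = 2 * N - 1 by omega] at key
    exact key
  · rintro b hb rfl hb1
    exact mem_crossSection.2 ⟨(mem_dualBoxEdges.1 hb).2, by simp [tip, hb1]⟩
  · intro x hx
    rw [mem_crossSection] at hx ⊢
    exact ⟨box_subset_box (by omega) (by omega) hx.1, hx.2⟩

/-- The interior [1-N, N-2]^d of the dual box is a single tile in the cube of size N + 1. The bound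
2 ≤ N ensures that this interior meets the hyperplane. -/
theorem dualBoxSepProb_mul_le_cubeSepProb (hp0 : 0 ≤ p) (hp1 : p < 1) (hq : 1 ≤ q) (e : Fin d)
    {N : ℕ} (hN : 2 ≤ N) :
    dualBoxSepProb d e p q N * (1 - p) ^ ((2 * N + 1) ^ (d - 1) - (2 * N - 2) ^ (d - 1))
      ≤ cubeSepProb d e p q (N + 1) := by
  have hJ : box d (1 - N) (N - 2) ⊆ box d (1 - (N + 1 : ℕ)) ((N + 1 : ℕ) - 1) :=
    box_subset_box (by omega) (by omega)
  have key := sepProb_mul_pow_card_le hp0 hp1 hq e (D := dualBoxEdges d N)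
    (E := touchingEdges (box d (1 - (N + 1 : ℕ)) ((N + 1 : ℕ) - 1)))
    (B := crossSection e (box d (1 - (N + 1 : ℕ)) ((N + 1 : ℕ) - 1))) hJ
    (touchingEdges_subset_dualBoxEdges N) ?_
    (fun b hb => tip_mem_crossSection (by omega) (by omega) hb) ?_
  · rw [card_crossSection_box e (by omega) (by omega),
      card_crossSection_box e (by omega) (by omega),
      show (((N + 1 : ℕ) : ℤ) - 1 + 1 - (1 - (N + 1 : ℕ))).toNat = 2 * N + 1 by omega,
      show ((N : ℤ) - 2 + 1 - (1 - N)).toNat = 2 * N - 2 by omega] at key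
    exact key
  · intro b hb
    exact mem_touchingEdges.2
      (Or.inl (box_subset_box (by omega) (by omega) (mem_dualBoxEdges.1 hb).1))
  · intro x hx
    rw [mem_crossSection] at hx ⊢
    exact ⟨hJ hx.1, hx.2⟩

end Boxes

/-! ### Convergence of approximately subadditive sequences -/

section Limits

/-- The limit is the infimum of g over n ≥ 1. The last hypothesis bounds the limsup of x by each g
n, and g - x → 0 keeps the liminf of x above that infimum. -/
theorem exists_tendsto_of_eventually_le {x g : ℕ → ℝ} (hg : ∀ n, 1 ≤ n → 0 ≤ g n)
    (hgx : Tendsto (fun n => g n - x n) atTop (𝓝 0))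
    (h : ∀ n, 1 ≤ n → ∀ ε > 0, ∀ᶠ N in atTop, x N ≤ g n + ε) :
    ∃ L : ℝ, 0 ≤ L ∧ Tendsto x atTop (𝓝 L) := by
  have hbdd : BddBelow (g '' Set.Ici 1) := ⟨0, by rintro _ ⟨n, hn, rfl⟩; exact hg n hn⟩
  have hne : (g '' Set.Ici 1).Nonempty := ⟨g 1, 1, Set.mem_Ici.2 le_rfl, rfl⟩
  refine ⟨sInf (g '' Set.Ici 1), le_csInf hne (by rintro _ ⟨n, hn, rfl⟩; exact hg n hn), ?_⟩
  rw [Metric.tendsto_atTop']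
  intro ε hε
  obtain ⟨_, ⟨n, hn, rfl⟩, hlt⟩ := exists_lt_of_csInf_lt hne
    (lt_add_of_pos_right (sInf (g '' Set.Ici 1)) (half_pos hε))
  have h1 := h n hn (ε / 4) (by linarith)
  have h2 := (Metric.tendsto_nhds.1 hgx) (ε / 2) (by linarith)
  obtain ⟨N, hN⟩ := ((h1.and h2).and (eventually_ge_atTop 1)).exists_forall_of_atTop
  refine ⟨N, fun m hm => ?_⟩
  obtain ⟨⟨h3, h4⟩, h5⟩ := hN m hm.le
  have h6 : sInf (g '' Set.Ici 1) ≤ g m := csInf_le hbdd ⟨m, h5, rfl⟩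
  rw [Real.dist_eq, abs_lt] at h4 ⊢
  constructor <;> linarith [h4.1, h4.2]

theorem tendsto_add_div_two_mul (a : ℝ) (M : ℕ) :
    Tendsto (fun N : ℕ => ((2 * (N : ℝ) + a) / (2 * N)) ^ M) atTop (𝓝 1) := by
  have h1 : Tendsto (fun N : ℕ => 1 + a / (2 * (N : ℝ))) atTop (𝓝 (1 + 0)) := by
    refine tendsto_const_nhds.add (Tendsto.div_atTop tendsto_const_nhds ?_)
    exact tendsto_natCast_atTop_atTop.const_mul_atTop two_pos
  rw [add_zero] at h1
  have h2 := h1.pow M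
  rw [one_pow] at h2
  refine h2.congr' ?_
  filter_upwards [eventually_ge_atTop 1] with N hN
  have : (N : ℝ) ≠ 0 := by positivity
  congr 1
  field_simp

theorem tendsto_pow_sub_pow_div (a b : ℝ) (M : ℕ) :
    Tendsto (fun N : ℕ => ((2 * (N : ℝ) + a) ^ M - (2 * N + b) ^ M) / (2 * (N : ℝ)) ^ M) atTop
      (𝓝 0) := by
  have := (tendsto_add_div_two_mul a M).sub (tendsto_add_div_two_mul b M)
  rw [sub_self] at this
  refine this.congr fun N => ?_
  rw [div_pow, div_pow, sub_div]

/-- Fekete's argument with an error: the uncovered proportion of the hyperplane does not vanish as N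
grows for fixed n, but it becomes small once n is large. -/
theorem exists_tendsto_of_approx_subadditive {f : ℕ → ℝ} (hf : ∀ n, 0 ≤ f n) {c : ℝ} (hc : 0 ≤ c)
    {M : ℕ} (h : ∀ n N : ℕ, 1 ≤ n → n ≤ N → f N ≤ ((N / n : ℕ) : ℝ) ^ M * f n
      + c * ((2 * N - 1) ^ M - ((N / n : ℕ) * (2 * n - 1)) ^ M)) :
    ∃ L : ℝ, 0 ≤ L ∧ Tendsto (fun N : ℕ => f N / (2 * (N : ℝ)) ^ M) atTop (𝓝 L) := by
  refine exists_tendsto_of_eventually_le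
    -- The second term is c times the asymptotic proportion of the hyperplane left uncovered by
    -- tiles of side 2n - 1 with period 2n.
    (g := fun n : ℕ => f n / (2 * (n : ℝ)) ^ M + c * (1 - ((2 * n + -1) / (2 * n)) ^ M)) ?_ ?_ ?_
  · intro n hn
    have hn' : (1 : ℝ) ≤ n := by exact_mod_cast hn
    have h1 : ((2 * (n : ℝ) + -1) / (2 * n)) ^ M ≤ 1 := by
      refine pow_le_one₀ (div_nonneg (by linarith) (by linarith)) ?_
      rw [div_le_one (by linarith)]
      linarith
    have h2 := div_nonneg (hf n) (pow_nonneg (by linarith : (0 : ℝ) ≤ 2 * n) M)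
    have h3 := mul_nonneg hc (sub_nonneg.2 h1)
    exact add_nonneg h2 h3
  · have := ((tendsto_const_nhds (x := (1 : ℝ))).sub (tendsto_add_div_two_mul (-1) M)).const_mul c
    simpa using this
  · intro n hn ε hε
    have hn' : (1 : ℝ) ≤ n := by exact_mod_cast hn
    have hk : Tendsto (fun N : ℕ => (((N / n : ℕ) : ℝ) / (2 * N)) ^ M) atTop
        (𝓝 ((1 / (2 * (n : ℝ))) ^ M)) := by
      have h1 := (tendsto_nat_floor_mul_div_atTop (R := ℝ) (a := 1 / (n : ℝ)) (by positivity)).comp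
        (tendsto_natCast_atTop_atTop (R := ℝ))
      have h2 := (h1.div_const 2).pow M
      refine (h2.congr fun N => ?_).trans (le_of_eq ?_)
      · have : ⌊1 / (n : ℝ) * N⌋₊ = N / n := by
          rw [one_div_mul_eq_div, Nat.floor_div_natCast, Nat.floor_natCast]
        simp only [Function.comp_apply, this]
        rw [div_div, mul_comm (N : ℝ) 2]
      · rw [div_div, mul_comm (n : ℝ) 2]
    have hlim : Tendsto (fun N : ℕ => (((N / n : ℕ) : ℝ) / (2 * N)) ^ M * f n
        + c * (((2 * (N : ℝ) + -1) / (2 * N)) ^ M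
          - (((N / n : ℕ) : ℝ) / (2 * N)) ^ M * (2 * n - 1) ^ M)) atTop
        (𝓝 ((1 / (2 * (n : ℝ))) ^ M * f n
          + c * (1 - (1 / (2 * (n : ℝ))) ^ M * (2 * n - 1) ^ M))) :=
      (hk.mul_const _).add (((tendsto_add_div_two_mul (-1) M).sub (hk.mul_const _)).const_mul c)
    have heq : (1 / (2 * (n : ℝ))) ^ M * f n
          + c * (1 - (1 / (2 * (n : ℝ))) ^ M * (2 * n - 1) ^ M)
        = f n / (2 * (n : ℝ)) ^ M + c * (1 - ((2 * n + -1) / (2 * n)) ^ M) := by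
      rw [div_pow, div_pow, one_pow, ← sub_eq_add_neg]
      ring
    rw [heq] at hlim
    filter_upwards [hlim.eventually (ge_mem_nhds (lt_add_of_pos_right _ hε)),
      eventually_ge_atTop n] with N hN hNn
    refine le_trans ?_ hN
    have hN0 : (0 : ℝ) < 2 * N := by
      have : (1 : ℝ) ≤ N := by exact_mod_cast hn.trans hNn
      linarith
    rw [div_le_iff₀ (by positivity)]
    refine (h n N hn hNn).trans (le_of_eq ?_)
    rw [div_pow, div_pow, mul_pow, sub_eq_add_neg (2 * (N : ℝ)) 1]
    field_simp

theorem neg_log_le_of_pow_mul_pow_le {x r y : ℝ} (hx : 0 < x) (hr : 0 < r) {m j : ℕ}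
    (h : x ^ m * r ^ j ≤ y) : -Real.log y ≤ m * -Real.log x + j * -Real.log r := by
  have h1 := Real.log_le_log (by positivity) h
  rw [Real.log_mul (by positivity) (by positivity), Real.log_pow, Real.log_pow] at h1
  linarith

/-- Three sequences of probabilities that differ by surface-order factors, the first of which is
approximately supermultiplicative, decay at the same surface-order rate. -/
theorem exists_common_rate {a w s : ℕ → ℝ} {r : ℝ} {M K : ℕ} (hr0 : 0 < r) (hr1 : r ≤ 1)
    (ha0 : ∀ N, 0 < a N) (ha1 : ∀ N, a N ≤ 1) (hw0 : ∀ N, 0 < w N) (hs0 : ∀ N, 1 ≤ N → 0 < s N)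
    (hsub : ∀ n N : ℕ, 1 ≤ n → n ≤ N →
      a n ^ ((N / n) ^ M) * r ^ ((2 * N - 1) ^ M - (N / n * (2 * n - 1)) ^ M) ≤ a N)
    (haw : ∀ N, 1 ≤ N → a N * r ^ ((2 * N + 2) ^ M - (2 * N - 1) ^ M) ≤ w (N + 1))
    (hwa : ∀ N, 2 ≤ N → w N * r ^ ((2 * N + 1) ^ M - (2 * N - 2) ^ M) ≤ a (N + 1))
    (has : ∀ N, 1 ≤ N → a N ≤ s N)
    (hsa : ∀ N, 1 ≤ N → s N * r ^ (K * ((2 * N + 1) ^ M - (2 * N - 1) ^ M)) ≤ a N) :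
    ∃ L : ℝ, 0 ≤ L ∧ Tendsto (fun N : ℕ => -Real.log (w N) / (2 * (N : ℝ)) ^ M) atTop (𝓝 L) ∧
      Tendsto (fun N : ℕ => -Real.log (s N) / (2 * (N : ℝ)) ^ M) atTop (𝓝 L) := by
  set c := -Real.log r with hc
  have hc0 : 0 ≤ c := neg_nonneg.2 (Real.log_nonpos hr0.le hr1)
  obtain ⟨L, hL0, hL⟩ := exists_tendsto_of_approx_subadditive (f := fun N => -Real.log (a N))
    (fun n => neg_nonneg.2 (Real.log_nonpos (ha0 n).le (ha1 n))) hc0 (M := M) (by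
      intro n N hn hN
      have h := neg_log_le_of_pow_mul_pow_le (ha0 n) hr0 (hsub n N hn hN)
      have hle : N / n * (2 * n - 1) ≤ 2 * N - 1 := by
        have h1 : N / n * n ≤ N := Nat.div_mul_le_self N n
        have h2 : 1 ≤ N / n := (Nat.one_le_div_iff (by omega)).2 hN
        have h3 : N / n * (2 * n - 1) + N / n = 2 * (N / n * n) := by
          rw [← Nat.mul_succ, show Nat.succ (2 * n - 1) = 2 * n by omega]; ring
        omega
      rw [Nat.cast_sub (Nat.pow_le_pow_left hle M)] at h
      push_cast [Nat.cast_sub (show 1 ≤ 2 * N by omega),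
        Nat.cast_sub (show 1 ≤ 2 * n by omega)] at h ⊢
      linarith)
  have hdiv : ∀ N : ℕ, (0 : ℝ) ≤ (2 * (N : ℝ)) ^ M := fun N => by positivity
  refine ⟨L, hL0, ?_, ?_⟩
  -- The sequence w at N is squeezed between cubes one size larger and one size smaller. The factors
  -- ((2N ± 2) / 2N)^M change the normalisation from N ± 1 to N, and the differences of powers are
  -- of lower order.
  · have hup : Tendsto (fun N : ℕ => -Real.log (a (N + 1)) / (2 * ((N + 1 : ℕ) : ℝ)) ^ M
        * ((2 * (N : ℝ) + 2) / (2 * N)) ^ M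
        - c * (((2 * (N : ℝ) + 1) ^ M - (2 * N + -2) ^ M) / (2 * (N : ℝ)) ^ M)) atTop (𝓝 L) := by
      have := ((hL.comp (tendsto_add_atTop_nat 1)).mul (tendsto_add_div_two_mul 2 M)).sub
        ((tendsto_pow_sub_pow_div 1 (-2) M).const_mul c)
      simpa using this
    have hdown : Tendsto (fun N : ℕ => -Real.log (a (N - 1)) / (2 * ((N - 1 : ℕ) : ℝ)) ^ M
        * ((2 * (N : ℝ) + -2) / (2 * N)) ^ M
        + c * (((2 * (N : ℝ) + 0) ^ M - (2 * N + -3) ^ M) / (2 * (N : ℝ)) ^ M)) atTop (𝓝 L) := by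
      have := ((hL.comp (tendsto_sub_atTop_nat 1)).mul (tendsto_add_div_two_mul (-2) M)).add
        ((tendsto_pow_sub_pow_div 0 (-3) M).const_mul c)
      simpa using this
    refine tendsto_of_tendsto_of_tendsto_of_le_of_le' hup hdown ?_ ?_
    · filter_upwards [eventually_ge_atTop 2] with N hN
      have h := neg_log_le_of_pow_mul_pow_le (m := 1) (hw0 N) hr0 (by simpa using hwa N hN)
      rw [Nat.cast_sub (Nat.pow_le_pow_left (by omega) M)] at h
      push_cast [Nat.cast_sub (show 2 ≤ 2 * N by omega)] at h
      have hN0 : (0 : ℝ) < N := by exact_mod_cast (by omega : 0 < N)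
      have e1 : (2 * ((N + 1 : ℕ) : ℝ)) = 2 * (N : ℝ) + 2 := by push_cast; ring
      rw [e1, div_pow, div_mul_div_cancel₀ (by positivity), ← mul_div_assoc, ← sub_div,
        ← sub_eq_add_neg]
      refine div_le_div_of_nonneg_right ?_ (hdiv N)
      linarith
    · filter_upwards [eventually_ge_atTop 2] with N hN
      obtain ⟨n, rfl⟩ : ∃ n, N = n + 1 := ⟨N - 1, by omega⟩
      have h := neg_log_le_of_pow_mul_pow_le (m := 1) (ha0 n) hr0
        (by simpa using haw n (by omega))
      rw [Nat.cast_sub (Nat.pow_le_pow_left (by omega) M)] at h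
      push_cast [Nat.cast_sub (show 1 ≤ 2 * n by omega)] at h
      have hn0 : (0 : ℝ) < n := by exact_mod_cast (by omega : 0 < n)
      rw [Nat.add_sub_cancel]
      have e1 : 2 * ((n + 1 : ℕ) : ℝ) + -2 = 2 * (n : ℝ) := by push_cast; ring
      have e2 : 2 * ((n + 1 : ℕ) : ℝ) + -3 = 2 * (n : ℝ) - 1 := by push_cast; ring
      have e3 : 2 * ((n + 1 : ℕ) : ℝ) + 0 = 2 * (n : ℝ) + 2 := by push_cast; ring
      rw [e1, e2, e3, div_pow, div_mul_div_cancel₀ (by positivity), ← mul_div_assoc, ← add_div]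
      refine div_le_div_of_nonneg_right ?_ (hdiv _)
      linarith
  -- For s the sizes already agree, so the only loss is the lower-order equator term.
  · have hup : Tendsto (fun N : ℕ => -Real.log (a N) / (2 * (N : ℝ)) ^ M
        - c * K * (((2 * (N : ℝ) + 1) ^ M - (2 * N + -1) ^ M) / (2 * (N : ℝ)) ^ M)) atTop
        (𝓝 L) := by
      have := hL.sub ((tendsto_pow_sub_pow_div 1 (-1) M).const_mul (c * K))
      simpa using this
    refine tendsto_of_tendsto_of_tendsto_of_le_of_le' hup hL ?_ ?_
    · filter_upwards [eventually_ge_atTop 1] with N hN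
      have h := neg_log_le_of_pow_mul_pow_le (m := 1) (hs0 N hN) hr0 (by simpa using hsa N hN)
      rw [Nat.cast_mul, Nat.cast_sub (Nat.pow_le_pow_left (by omega) M)] at h
      push_cast [Nat.cast_sub (show 1 ≤ 2 * N by omega)] at h
      rw [← mul_div_assoc, ← sub_div, ← sub_eq_add_neg]
      refine div_le_div_of_nonneg_right ?_ (hdiv N)
      linarith
    · filter_upwards [eventually_ge_atTop 1] with N hN
      refine div_le_div_of_nonneg_right ?_ (hdiv N)
      exact neg_le_neg (Real.log_le_log (ha0 N) (has N hN))

end Limits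

/-! ### The wired random-cluster model on a cube -/

section Surface

variable {d : ℕ}

theorem edgeGraph_adj_of_mem {η : Set (Edge d)} {b : Edge d} (hb : b ∈ η) :
    (edgeGraph η).Adj b.1 (tip b) := by
  unfold edgeGraph
  rw [SimpleGraph.fromRel_adj]
  refine ⟨fun h => ?_, Or.inl ⟨b.2, hb, rfl⟩⟩
  have := congrFun h b.2
  simp [tip] at this

theorem edgeGraph_adj_iff {η : Set (Edge d)} {x y : Vertex d} :
    (edgeGraph η).Adj x y ↔ ∃ b ∈ η, (b.1 = x ∧ tip b = y) ∨ (b.1 = y ∧ tip b = x) := by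
  constructor
  · unfold edgeGraph
    rw [SimpleGraph.fromRel_adj]
    rintro ⟨-, ⟨j, hj, rfl⟩ | ⟨j, hj, rfl⟩⟩
    · exact ⟨_, hj, Or.inl ⟨rfl, rfl⟩⟩
    · exact ⟨_, hj, Or.inr ⟨rfl, rfl⟩⟩
  · rintro ⟨b, hb, ⟨rfl, rfl⟩ | ⟨rfl, rfl⟩⟩
    · exact edgeGraph_adj_of_mem hb
    · exact (edgeGraph_adj_of_mem hb).symm

theorem eq_of_reachable {η : Set (Edge d)} {α : Type*} {f : Vertex d → α}
    (h : ∀ b ∈ η, f b.1 = f (tip b)) {x y : Vertex d} (hxy : (edgeGraph η).Reachable x y) :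
    f x = f y := by
  obtain ⟨w⟩ := hxy
  induction w with
  | nil => rfl
  | cons hadj _ ih =>
    refine Eq.trans ?_ ih
    obtain ⟨b, hb, ⟨rfl, rfl⟩ | ⟨rfl, rfl⟩⟩ := edgeGraph_adj_iff.1 hadj
    · exact h b hb
    · exact (h b hb).symm

theorem inBoxBoundary_vertex {N : ℕ} {x : Vertex d} :
    InBoxBoundary N ((x, ∅) : Cell d) ↔ x ∈ box d (-N) N ∧ x ∉ box d (1 - N) (N - 1) := by
  unfold InBoxBoundary InBox
  simp only [Finset.notMem_empty, if_false, not_false_eq_true, true_and, mem_box]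
  refine and_congr_right fun h => ?_
  rw [not_forall]
  refine exists_congr fun m => ?_
  have := h m
  omega

theorem boxEdges_eq {N : ℕ} (hN : 1 ≤ N) :
    boxEdges d N = touchingEdges (box d (1 - N) (N - 1)) := by
  ext b
  have hb : b ∈ boxEdges d N ↔ InBox N (edgeCell b) ∧ ¬ InBoxBoundary N (edgeCell b) := by
    unfold boxEdges
    simp only [Finset.mem_filter, Finset.mem_product, Finset.mem_univ, and_true,
      and_iff_right_iff_imp]
    rintro ⟨h, -⟩
    refine Finset.mem_Icc.2 ⟨fun m => (h m).1, fun m => ?_⟩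
    have := (h m).2
    simp only [edgeCell] at this
    split_ifs at this <;> simp only <;> omega
  rw [hb, mem_touchingEdges, mem_box, mem_box]
  unfold InBoxBoundary InBox edgeCell
  simp only [Finset.mem_singleton]
  have htip : ∀ m, tip b m = if m = b.2 then b.1 m + 1 else b.1 m := by
    intro m
    by_cases h : m = b.2
    · subst h; simp [tip]
    · simp [tip, h]
  constructor
  · rintro ⟨h1, h2⟩
    have h2 : ∀ m, m ≠ b.2 → b.1 m ≠ -N ∧ b.1 m ≠ N := by
      intro m hm
      by_contra h
      exact h2 ⟨h1, m, hm, by tauto⟩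
    have h3 : ∀ m, m ≠ b.2 → 1 - (N : ℤ) ≤ b.1 m ∧ b.1 m ≤ N - 1 := by
      intro m hm
      have ha := h1 m
      have hb := h2 m hm
      rw [if_neg hm] at ha
      omega
    have h4 := h1 b.2
    rw [if_pos rfl] at h4
    by_cases hlow : b.1 b.2 = -N
    · refine Or.inr fun m => ?_
      rw [htip]
      split_ifs with hm
      · subst hm; omega
      · exact h3 m hm
    · refine Or.inl fun m => ?_
      by_cases hm : m = b.2
      · subst hm; omega
      · exact h3 m hm
  · intro h
    have h3 : ∀ m, m ≠ b.2 → 1 - (N : ℤ) ≤ b.1 m ∧ b.1 m ≤ N - 1 := by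
      intro m hm
      rcases h with h | h
      · exact h m
      · have := h m
        rwa [htip, if_neg hm] at this
    have h4 : -(N : ℤ) ≤ b.1 b.2 ∧ b.1 b.2 + 1 ≤ N := by
      rcases h with h | h
      · have := h b.2
        omega
      · have := h b.2
        rw [htip, if_pos rfl] at this
        omega
    refine ⟨fun m => ?_, ?_⟩
    · by_cases hm : m = b.2
      · subst hm; simpa using h4
      · have := h3 m hm
        rw [if_neg hm]
        omega
    · rintro ⟨-, m, hm, h⟩
      have := h3 m hm
      omega

/-! ### Counting clusters with a wired boundary -/

/-- The edges in the boundary of the cube. -/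
def boundaryEdges (d N : ℕ) : Set (Edge d) := {b | InBoxBoundary N (edgeCell b)}

theorem endpoints_notMem_of_mem_boundaryEdges {N : ℕ} {b : Edge d} (hb : b ∈ boundaryEdges d N) :
    b.1 ∉ box d (1 - N) (N - 1) ∧ tip b ∉ box d (1 - N) (N - 1) := by
  obtain ⟨-, m, hm, h⟩ := hb
  simp only [edgeCell, Finset.mem_singleton] at hm h
  have htip : tip b m = b.1 m := by simp [tip, hm]
  constructor
  · intro h'
    have := mem_box.1 h' m
    omega
  · intro h'
    have := mem_box.1 h' m
    omega

/-- Changing a coordinate m other than the extremal one j never leaves the face, so the path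
consists of boundary edges in direction m. -/
theorem reachable_update_of_face {N : ℕ} {x : Vertex d} (hx : x ∈ box d (-N) N) {j m : Fin d}
    (hjm : j ≠ m) (hj : x j = -N ∨ x j = N) {v : ℤ} (hv : -N ≤ v) (hv' : v ≤ N) :
    (edgeGraph (boundaryEdges d N)).Reachable x (Function.update x m v) := by
  have step : ∀ k : ℕ, (k : ℤ) ≤ 2 * N → (edgeGraph (boundaryEdges d N)).Reachable
      (Function.update x m (-N)) (Function.update x m (-N + k)) := by
    intro k
    induction k with
    | zero => simp
    | succ k ih =>
      intro hk
      push_cast at hk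
      refine (ih (by omega)).trans ?_
      have hmem : ((Function.update x m (-N + k), m) : Edge d) ∈ boundaryEdges d N := by
        refine ⟨fun i => ?_, j, ?_, ?_⟩
        · simp only [edgeCell, Finset.mem_singleton]
          by_cases hi : i = m
          · subst hi; simp only [Function.update_self, if_true]; omega
          · simpa [hi] using mem_box.1 hx i
        · simpa [edgeCell] using hjm
        · simpa [edgeCell, hjm] using hj
      have := (edgeGraph_adj_of_mem hmem).reachable
      have htip : tip (Function.update x m (-N + k), m)
          = Function.update x m (-N + (k + 1 : ℕ) : ℤ) := by
        ext i
        by_cases hi : i = m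
        · subst hi; simp [tip, add_assoc]
        · simp [tip, hi]
      rwa [htip] at this
  have all : ∀ u : ℤ, -N ≤ u → u ≤ N → (edgeGraph (boundaryEdges d N)).Reachable
      (Function.update x m (-N)) (Function.update x m u) := by
    intro u h1 h2
    have := step (u + N).toNat (by omega)
    rwa [Int.toNat_of_nonneg (by omega), show -(N : ℤ) + (u + N) = u by ring] at this
  have h1 := all (x m) (mem_box.1 hx m).1 (mem_box.1 hx m).2
  rw [Function.update_eq_self] at h1
  exact h1.symm.trans (all v hv hv')

/-- Within a face on which x_j is extremal, all other coordinates are first raised to N. Then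
another coordinate is extremal, and j can be moved to N along its face. This needs d ≥ 2: in
dimension one the boundary is two isolated points. -/
theorem reachable_corner (hd : 2 ≤ d) {N : ℕ} {x : Vertex d} (hx : x ∈ box d (-N) N)
    (hx' : x ∉ box d (1 - N) (N - 1)) :
    (edgeGraph (boundaryEdges d N)).Reachable x fun _ => (N : ℤ) := by
  classical
  obtain ⟨j, hj⟩ : ∃ j, x j = -N ∨ x j = N := by
    by_contra! h
    refine hx' (mem_box.2 fun m => ?_)
    have := mem_box.1 hx m
    have := h m
    omega
  have key : ∀ s : Finset (Fin d), j ∉ s → (edgeGraph (boundaryEdges d N)).Reachable x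
      (s.piecewise (fun _ => (N : ℤ)) x) := by
    intro s
    induction s using Finset.induction_on with
    | empty => simp
    | insert m s hm ih =>
      intro hjs
      rw [Finset.mem_insert, not_or] at hjs
      refine (ih hjs.2).trans ?_
      rw [Finset.piecewise_insert]
      refine reachable_update_of_face (mem_box.2 fun i => ?_) hjs.1 ?_ (by omega) (by omega)
      · by_cases hi : i ∈ s
        · simp [hi]
        · simpa [hi] using mem_box.1 hx i
      · simpa [hjs.2] using hj
  have h1 := key (Finset.univ.erase j) (Finset.notMem_erase _ _)
  refine h1.trans ?_
  have : Nontrivial (Fin d) := Fin.nontrivial_iff_two_le.2 hd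
  obtain ⟨i, hi⟩ := exists_ne j
  have h2 := reachable_update_of_face (N := N)
    (x := (Finset.univ.erase j).piecewise (fun _ => (N : ℤ)) x) (j := i) (m := j) (v := N)
    (mem_box.2 fun k => ?_) hi (by simp [hi]) (by omega) le_rfl
  · convert h2 using 1
    ext k
    by_cases hk : k = j
    · subst hk; simp
    · simp [hk]
  · by_cases hk : k = j
    · subst hk; simpa using mem_box.1 hx k
    · simp [hk]

/-- All boundary vertices form part of one cluster, on which the functions in `clusterFns` vanish;
it accounts for the + 1. On every other cluster meeting the cube the value is free, so the dimension
counts these clusters. -/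
theorem numClusters_wired (hd : 2 ≤ d) {N : ℕ} {Q : Finset (Edge d)} (hQ : Q ⊆ boxEdges d N) :
    numClusters ((Q : Set (Edge d)) ∪ boundaryEdges d N) (boxVertices d N)
      = clusterRank (box d (1 - N) (N - 1)) Q + 1 := by
  classical
  set I := box d (1 - N) (N - 1) with hI
  set η := (Q : Set (Edge d)) ∪ boundaryEdges d N with hη
  set G := edgeGraph η with hG
  set c₀ := G.connectedComponentMk fun _ => (N : ℤ) with hc₀
  set C := G.connectedComponentMk '' (boxVertices d N : Set (Vertex d)) with hC
  have hS : ∀ x, x ∈ boxVertices d N ↔ x ∈ box d (-N) N := fun x => Iff.rfl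
  have hIS : ∀ x ∈ I, x ∈ boxVertices d N := fun x hx =>
    (hS x).2 (box_subset_box (by omega) (by omega) hx)
  have hle : edgeGraph (boundaryEdges d N) ≤ G := by
    intro x y hxy
    obtain ⟨b, hb, h⟩ := edgeGraph_adj_iff.1 hxy
    exact edgeGraph_adj_iff.2 ⟨b, Or.inr hb, h⟩
  have hbd : ∀ x ∈ boxVertices d N, x ∉ I → G.connectedComponentMk x = c₀ := fun x hx hx' =>
    SimpleGraph.ConnectedComponent.eq.2 ((reachable_corner hd ((hS x).1 hx) hx').mono hle)
  have hconst : ∀ h ∈ clusterFns I Q, ∀ x y, G.Reachable x y → h x = h y := by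
    intro h hh x y hxy
    refine eq_of_reachable (f := h) (fun b hb => ?_) hxy
    rcases hb with hb | hb
    · exact hh.2 b hb
    · have := endpoints_notMem_of_mem_boundaryEdges hb
      rw [hh.1 _ this.1, hh.1 _ this.2]
  have hcorner : (fun _ => (N : ℤ)) ∉ I := by
    intro h
    have := (mem_box.1 h ⟨0, by omega⟩).2
    omega
  have hC0 : c₀ ∈ C := ⟨fun _ => (N : ℤ), (hS _).2 (mem_box.2 fun m => by omega), rfl⟩
  have hCfin : C.Finite := (boxVertices d N).finite_toSet.image _
  have : Finite ↥(C \ {c₀}) := (hCfin.subset Set.sdiff_subset).to_subtype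
  have hrep : ∀ c : ↥(C \ {c₀}), ∃ x ∈ I, G.connectedComponentMk x = c := by
    rintro ⟨_, ⟨x, hx, rfl⟩, hne⟩
    refine ⟨x, ?_, rfl⟩
    by_contra hxI
    exact hne (hbd x hx hxI)
  choose rep hrepI hrepc using hrep
  -- Evaluation at one interior representative of each cluster other than the boundary cluster `c₀`;
  -- this will be an isomorphism.
  let L : clusterFns I Q →ₗ[ℚ] (↥(C \ {c₀}) → ℚ) :=
    { toFun := fun h c => (h : Vertex d →₀ ℚ) (rep c)
      map_add' := fun _ _ => rfl
      map_smul' := fun _ _ => rfl }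
  have hLinj : Function.Injective L := by
    rw [injective_iff_map_eq_zero]
    rintro ⟨h, hh⟩ h0
    ext x
    by_cases hx : x ∈ I
    · by_cases hxc : G.connectedComponentMk x = c₀
      · rw [show ((⟨h, hh⟩ : clusterFns I Q) : Vertex d →₀ ℚ) x = h x from rfl,
          hconst h hh x _ (SimpleGraph.ConnectedComponent.eq.1 hxc), hh.1 _ hcorner]
        rfl
      · have hmem : G.connectedComponentMk x ∈ C \ {c₀} := ⟨⟨x, hIS x hx, rfl⟩, hxc⟩
        have h1 := congrFun h0 ⟨_, hmem⟩
        have h2 := hconst h hh (rep ⟨_, hmem⟩) x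
          (SimpleGraph.ConnectedComponent.eq.1 (hrepc ⟨_, hmem⟩))
        exact h2.symm.trans h1
    · exact hh.1 x hx
  have hLsurj : Function.Surjective L := by
    intro φ
    let g : Vertex d → ℚ := fun x =>
      if hx : x ∈ I ∧ G.connectedComponentMk x ∈ C \ {c₀} then φ ⟨_, hx.2⟩ else 0
    have hg0 : ∀ x ∉ I, g x = 0 := fun x hx => dif_neg fun h => hx h.1
    have hgfin : (Function.support g).Finite := I.finite_toSet.subset fun x hx => by
      by_contra h
      exact hx (hg0 x h)
    have hgc : ∀ x ∈ boxVertices d N, ∀ y ∈ boxVertices d N,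
        G.connectedComponentMk x = G.connectedComponentMk y → g x = g y := by
      have hz : ∀ x ∈ boxVertices d N, G.connectedComponentMk x ∈ C \ {c₀} → x ∈ I := by
        intro x hx h
        by_contra hxI
        exact h.2 (hbd x hx hxI)
      intro x hx y hy hxy
      by_cases hxC : G.connectedComponentMk x ∈ C \ {c₀}
      · have hyC : G.connectedComponentMk y ∈ C \ {c₀} := hxy ▸ hxC
        simp only [g]
        rw [dif_pos ⟨hz x hx hxC, hxC⟩, dif_pos ⟨hz y hy hyC, hyC⟩]
        congr 1
        exact Subtype.ext hxy
      · have hyC : G.connectedComponentMk y ∉ C \ {c₀} := hxy ▸ hxC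
        simp only [g]
        rw [dif_neg fun h => hxC h.2, dif_neg fun h => hyC h.2]
    refine ⟨⟨Finsupp.ofSupportFinite g hgfin, hg0, fun b hb => ?_⟩, ?_⟩
    · have hbE := hQ hb
      have hb1 : InBox N (edgeCell b) := (Finset.mem_filter.1 hbE).2.1
      refine hgc b.1 ?_ (tip b) ?_ ?_
      · exact (Finset.mem_product.1 (Finset.mem_filter.1 hbE).1).1
      · rw [hS, mem_box]
        intro m
        have := hb1 m
        simp only [edgeCell, Finset.mem_singleton] at this
        by_cases hm : m = b.2
        · subst hm; simp only [if_true] at this; simp [tip]; omega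
        · simpa [tip, hm] using this
      · exact SimpleGraph.ConnectedComponent.eq.2
          (edgeGraph_adj_of_mem (Or.inl hb : b ∈ η)).reachable
    · funext c
      have h1 : rep c ∈ I ∧ G.connectedComponentMk (rep c) ∈ C \ {c₀} :=
        ⟨hrepI c, (hrepc c).symm ▸ c.2⟩
      change g (rep c) = φ c
      simp only [g]
      rw [dif_pos h1]
      congr 1
      exact Subtype.ext (hrepc c)
  have hrank : clusterRank I Q = (C \ {c₀}).ncard := by
    unfold clusterRank
    rw [LinearEquiv.finrank_eq (LinearEquiv.ofBijective L ⟨hLinj, hLsurj⟩)]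
    have := Fintype.ofFinite ↥(C \ {c₀})
    rw [Module.finrank_fintype_fun_eq_card, ← Nat.card_eq_fintype_card, Nat.card_coe_set_eq]
  change C.ncard = _
  rw [hrank, Set.ncard_sdiff_singleton_add_one hC0 hCfin]

/-- The boundary cluster contributes the same factor q to every weight, so it cancels in the
normalisation. -/
theorem rcmWiredProb_eq (hd : 2 ≤ d) {N : ℕ} (hN : 1 ≤ N) (p : ℝ) {q : ℝ} (hq : q ≠ 0)
    (A : Set (Finset (Edge d))) :
    rcmWiredProb d N p q A = gibbsProb (touchingEdges (box d (1 - N) (N - 1)))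
      (wiredWeight p q (box d (1 - N) (N - 1)) (touchingEdges (box d (1 - N) (N - 1)))) A := by
  unfold rcmWiredProb
  rw [← boxEdges_eq hN]
  refine gibbsProb_congr hq id id (fun _ h => h) (fun _ h => h) (fun _ _ => rfl) (fun _ _ => rfl)
    (fun Q hQ => ?_) fun _ _ => Iff.rfl
  have := numClusters_wired hd hQ
  unfold boundaryEdges at this
  unfold rcmWeight wiredWeight
  rw [this, pow_succ, id]
  ring

/-! ### Hemispheres and interfaces -/

theorem separated_subset_hemispheresDisconnected (e : Fin d) (N : ℕ) :
    separated e (box d (1 - N) (N - 1)) ⊆ hemispheresDisconnected d N e := by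
  rintro Q ⟨U, h1, h2⟩ x y hx hy hx0 hy0 hxy
  rw [inBoxBoundary_vertex] at hx hy
  have h3 : (x ∈ U) = (y ∈ U) :=
    eq_of_reachable (f := fun x => x ∈ U) (fun b hb => propext (h2 b hb)) hxy
  have h4 := (h1 x hx.2).2 hx0.le
  rw [h3] at h4
  have := (h1 y hy.2).1 h4
  omega

theorem isLowerSet_hemispheresDisconnected (e : Fin d) (N : ℕ) :
    IsLowerSet (hemispheresDisconnected d N e) := by
  intro Q Q' h hQ x y hx hy hx0 hy0 hxy
  refine hQ x y hx hy hx0 hy0 (hxy.mono ?_)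
  intro a b hab
  obtain ⟨b, hb, h'⟩ := edgeGraph_adj_iff.1 hab
  exact edgeGraph_adj_iff.2 ⟨b, h hb, h'⟩

/-- The lattice points of the cube that lie on the equator. -/
def equatorVertices (e : Fin d) (N : ℕ) : Finset (Vertex d) :=
  crossSection e (box d (-N) N) \ crossSection e (box d (1 - N) (N - 1))

theorem card_equatorVertices (e : Fin d) {N : ℕ} (hN : 1 ≤ N) :
    (equatorVertices e N).card = (2 * N + 1) ^ (d - 1) - (2 * N - 1) ^ (d - 1) := by
  unfold equatorVertices
  rw [Finset.card_sdiff_of_subset, card_crossSection_box e (by omega) (by omega),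
    card_crossSection_box e (by omega) (by omega),
    show ((N : ℤ) + 1 - -N).toNat = 2 * N + 1 by omega,
    show ((N : ℤ) - 1 + 1 - (1 - N)).toNat = 2 * N - 1 by omega]
  intro x hx
  rw [mem_crossSection] at hx ⊢
  exact ⟨box_subset_box (by omega) (by omega) hx.1, hx.2⟩

theorem card_touchingEdges_le (I : Finset (Vertex d)) :
    (touchingEdges I).card ≤ 2 * d * I.card := by
  refine (Finset.card_union_le _ _).trans ?_
  refine (Nat.add_le_add_left Finset.card_image_le _).trans ?_
  rw [Finset.card_product, Finset.card_univ, Fintype.card_fin]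
  exact le_of_eq (by ring)

/-- Inside the cube the interface is bounded by the set of points joined to the upper hemisphere.
Boundary vertices with x_e = 0 belong to neither hemisphere and could have clusters on the wrong
side; with no open edge at the equator they cannot interfere. -/
theorem mem_separated_of_hemispheresDisconnected {e : Fin d} {N : ℕ}
    {Q : Finset (Edge d)} (hQE : Q ⊆ touchingEdges (box d (1 - N) (N - 1)))
    (hQ : Q ∈ hemispheresDisconnected d N e)
    (hQF : Disjoint Q (touchingEdges (equatorVertices e N))) :
    Q ∈ separated e (box d (1 - N) (N - 1)) := by
  set I := box d (1 - N) (N - 1) with hI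
  set G := edgeGraph (Q : Set (Edge d)) with hG
  let up : Vertex d → Prop := fun x =>
    ∃ z, InBoxBoundary N ((z, ∅) : Cell d) ∧ 0 < z e ∧ G.Reachable z x
  have hup : ∀ x y, G.Adj x y → (up x ↔ up y) := fun x y h =>
    ⟨fun ⟨z, h1, h2, h3⟩ => ⟨z, h1, h2, h3.trans h.reachable⟩,
      fun ⟨z, h1, h2, h3⟩ => ⟨z, h1, h2, h3.trans h.symm.reachable⟩⟩
  have hbox : ∀ b ∈ Q, b.1 ∈ box d (-N) N ∧ tip b ∈ box d (-N) N := by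
    intro b hb
    have h : ∀ m, -(N : ℤ) ≤ b.1 m ∧ b.1 m ≤ N ∧ -(N : ℤ) ≤ tip b m ∧ tip b m ≤ N := by
      intro m
      have := tip_apply b m
      rcases mem_touchingEdges.1 (hQE hb) with h | h
      · have := mem_box.1 h m
        omega
      · have := mem_box.1 h m
        omega
    exact ⟨mem_box.2 fun m => ⟨(h m).1, (h m).2.1⟩, mem_box.2 fun m => (h m).2.2⟩
  have key : ∀ b ∈ Q, ∀ x, (x = b.1 ∨ x = tip b) → x ∉ I → (0 ≤ x e ↔ up x) := by
    intro b hb x hx hxI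
    have hxb : x ∈ box d (-N) N := by
      rcases hx with rfl | rfl
      · exact (hbox b hb).1
      · exact (hbox b hb).2
    have hbd := inBoxBoundary_vertex.2 ⟨hxb, hxI⟩
    have hne : x e ≠ 0 := by
      intro h0
      refine Finset.disjoint_left.1 hQF hb (mem_touchingEdges.2 ?_)
      have : x ∈ equatorVertices e N := Finset.mem_sdiff.2
        ⟨mem_crossSection.2 ⟨hxb, h0⟩, fun h => hxI (mem_crossSection.1 h).1⟩
      rcases hx with rfl | rfl
      · exact Or.inl this
      · exact Or.inr this
    constructor
    · exact fun h => ⟨x, hbd, lt_of_le_of_ne h hne.symm, .refl x⟩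
    · rintro ⟨z, h1, h2, h3⟩
      by_contra! h
      exact hQ z x h1 hbd h2 h h3
  refine ⟨{x | (x ∈ I ∧ up x) ∨ (x ∉ I ∧ 0 ≤ x e)}, fun x hx => ?_, fun b hb => ?_⟩
  · simp [hx]
  · have h1 : ∀ x, (x = b.1 ∨ x = tip b) → (((x ∈ I ∧ up x) ∨ (x ∉ I ∧ 0 ≤ x e)) ↔ up x) := by
      intro x hx
      by_cases hxI : x ∈ I
      · simp [hxI]
      · simp only [hxI, false_and, not_false_eq_true, true_and, false_or]
        exact key b hb x hx hxI
    simp only [Set.mem_ofPred_eq]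
    rw [h1 _ (Or.inl rfl), h1 _ (Or.inr rfl)]
    exact hup _ _ (edgeGraph_adj_of_mem hb)

variable {p q : ℝ}

theorem cubeSepProb_le_rcmWiredProb (hd : 2 ≤ d) (hp0 : 0 ≤ p) (hp1 : p < 1) (hq : 1 ≤ q)
    (e : Fin d) {N : ℕ} (hN : 1 ≤ N) :
    cubeSepProb d e p q N ≤ rcmWiredProb d N p q (hemispheresDisconnected d N e) := by
  rw [rcmWiredProb_eq hd hN p (by linarith)]
  exact gibbsProb_mono (isFKGWeight_wiredWeight hp0 hp1 hq _ _).nonneg fun Q _ hQ =>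
    separated_subset_hemispheresDisconnected e N hQ

/-- FKG allows all edges at the equator, at most 2d per vertex, to be closed in addition to the
disconnection event. -/
theorem rcmWiredProb_mul_le_cubeSepProb (hd : 2 ≤ d) (hp0 : 0 ≤ p) (hp1 : p < 1) (hq : 1 ≤ q)
    (e : Fin d) {N : ℕ} (hN : 1 ≤ N) :
    rcmWiredProb d N p q (hemispheresDisconnected d N e)
        * (1 - p) ^ (2 * d * ((2 * N + 1) ^ (d - 1) - (2 * N - 1) ^ (d - 1)))
      ≤ cubeSepProb d e p q N := by
  rw [rcmWiredProb_eq hd hN p (by linarith)]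
  have hw := isFKGWeight_wiredWeight hp0 hp1 hq (box d (1 - N) (N - 1))
    (touchingEdges (box d (1 - N) (N - 1)))
  have h1 : (1 - p) ^ (2 * d * ((2 * N + 1) ^ (d - 1) - (2 * N - 1) ^ (d - 1)))
      ≤ (1 - p) ^ (touchingEdges (equatorVertices e N)).card := by
    refine pow_le_pow_of_le_one (by linarith) (by linarith) ?_
    rw [← card_equatorVertices e hN]
    exact card_touchingEdges_le _
  refine (mul_le_mul_of_nonneg_left (h1.trans (pow_le_gibbsProb_disjoint hp0 hp1 hq
    (box d (1 - N) (N - 1)) (touchingEdges (box d (1 - N) (N - 1))) _))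
    (gibbsProb_nonneg hw.nonneg _)).trans ?_
  refine (hw.mul_le_inter (isLowerSet_hemispheresDisconnected e N)
    (isLowerSet_disjoint _)).trans ?_
  exact gibbsProb_mono hw.nonneg fun Q hQE hQ =>
    mem_separated_of_hemispheresDisconnected hQE hQ.1 hQ.2

end Surface

/-! ### The cubical boundary operator -/

section Homology

variable {d : ℕ} {R : Type*} [Ring R]

/-- The sign with which direction `j` contributes to the boundary of a cell with directions
`insert j S`. -/
def sgn (R : Type*) [Ring R] (S : Finset (Fin d)) (j : Fin d) : R :=
  (-1) ^ (S.filter (· < j)).card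

theorem sgn_eq_or (S : Finset (Fin d)) (j : Fin d) : sgn R S j = 1 ∨ sgn R S j = -1 :=
  neg_one_pow_eq_or R _

theorem sgn_mul_self (S : Finset (Fin d)) (j : Fin d) : sgn R S j * sgn R S j = 1 := by
  rcases sgn_eq_or (R := R) S j with h | h <;> simp [h]

theorem sgn_insert {S : Finset (Fin d)} {j : Fin d} (hj : j ∉ S) (k : Fin d) :
    sgn R (insert j S) k = if j < k then -sgn R S k else sgn R S k := by
  unfold sgn
  rw [Finset.filter_insert]
  split_ifs with h
  · rw [Finset.card_insert_of_notMem (by simp [hj]), pow_succ]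
    simp
  · rfl

/-- Read through coefficients, ∂ is a signed finite difference: the cell (x, S) is an upper or a
lower face of the cells having one more direction. All later homological arguments use this form. -/
theorem cellBoundary_apply (α : Cell d →₀ R) (x : Vertex d) (S : Finset (Fin d)) :
    cellBoundary R d α (x, S) = ∑ j ∈ Sᶜ, sgn R S j *
      (α (x - Pi.single j 1, insert j S) - α (x, insert j S)) := by
  classical
  induction α using Finsupp.induction_linear with
  | zero => simp
  | add f g hf hg =>
    rw [map_add, Finsupp.add_apply, hf, hg, ← Finset.sum_add_distrib]
    refine Finset.sum_congr rfl fun j _ => ?_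
    rw [← mul_add, Finsupp.add_apply, Finsupp.add_apply]
    congr 1
    abel
  | single σ c =>
    obtain ⟨y, T⟩ := σ
    have h1 : cellBoundary R d (Finsupp.single (y, T) c) (x, S)
        = ∑ j ∈ T, sgn R (T.erase j) j * ((if y + Pi.single j 1 = x ∧ T.erase j = S then c else 0)
            - if y = x ∧ T.erase j = S then c else 0) := by
      unfold cellBoundary
      rw [Finsupp.linearCombination_single, Finsupp.smul_apply, Finsupp.finsetSum_apply,
        smul_eq_mul, Finset.mul_sum]
      refine Finset.sum_congr rfl fun j _ => ?_
      have h2 : (T.erase j).filter (· < j) = T.filter (· < j) := by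
        ext i
        simp only [Finset.mem_filter, Finset.mem_erase]
        exact ⟨fun h => ⟨h.1.2, h.2⟩, fun h => ⟨⟨h.2.ne, h.1⟩, h.2⟩⟩
      have h3 : ((-1 : R) ^ (T.filter (· < j)).card) = sgn R (T.erase j) j := by
        unfold sgn
        rw [h2]
      simp only [h3, Finsupp.smul_apply, Finsupp.sub_apply, Finsupp.single_apply, smul_eq_mul,
        Prod.mk.injEq]
      rcases sgn_eq_or (R := R) (T.erase j) j with h | h <;> rw [h] <;>
        split_ifs <;> simp
    rw [h1, ← Finset.univ_inter T, ← Finset.univ_inter Sᶜ, ← Finset.sum_ite_mem,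
      ← Finset.sum_ite_mem, Finset.univ_inter]
    refine Finset.sum_congr rfl fun j _ => ?_
    simp only [Finset.mem_compl, Finsupp.single_apply, Prod.mk.injEq]
    by_cases hjS : j ∈ S
    · have : T.erase j ≠ S := fun h => Finset.notMem_erase j T (h ▸ hjS)
      simp [hjS, this]
    · by_cases hjT : j ∈ T
      · rw [if_pos hjT, if_pos hjS]
        by_cases hT : T = insert j S
        · subst hT
          simp only [Finset.erase_insert hjS, and_true]
          congr 2
          refine if_congr ?_ rfl rfl
          exact eq_sub_iff_add_eq.symm
        · have : T.erase j ≠ S := fun h => hT (by rw [← h, Finset.insert_erase hjT])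
          simp [hT, this]
      · have : T ≠ insert j S := fun h => hjT (h ▸ Finset.mem_insert_self _ _)
        simp [hjT, this]

/-- The terms are indexed by ordered pairs of distinct directions outside S. Swapping the pair keeps
the second difference and reverses the sign, since by `sgn_insert` exactly one of the two orders
flips it. -/
theorem cellBoundary_cellBoundary (α : Cell d →₀ R) :
    cellBoundary R d (cellBoundary R d α) = 0 := by
  classical
  ext ⟨x, S⟩
  rw [cellBoundary_apply, Finsupp.zero_apply]
  have h1 : ∀ j ∈ Sᶜ, sgn R S j * (cellBoundary R d α (x - Pi.single j 1, insert j S)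
      - cellBoundary R d α (x, insert j S))
      = ∑ k ∈ (insert j S)ᶜ, sgn R S j * (sgn R (insert j S) k *
        (α (x - Pi.single j 1 - Pi.single k 1, insert k (insert j S))
          - α (x - Pi.single j 1, insert k (insert j S))
          - α (x - Pi.single k 1, insert k (insert j S)) + α (x, insert k (insert j S)))) := by
    intro j _
    rw [cellBoundary_apply, cellBoundary_apply, ← Finset.sum_sub_distrib, Finset.mul_sum]
    refine Finset.sum_congr rfl fun k _ => ?_
    rw [← mul_sub]
    congr 2
    abel
  rw [Finset.sum_congr rfl h1, Finset.sum_sigma']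
  refine Finset.sum_involution (fun a _ => ⟨a.2, a.1⟩) ?_ ?_ ?_ ?_
  · rintro ⟨j, k⟩ hjk
    simp only [Finset.mem_sigma, Finset.mem_compl, Finset.mem_insert, not_or] at hjk
    obtain ⟨hj, hkj, hk⟩ := hjk
    simp only
    rw [Finset.insert_comm j k S, sgn_insert hj, sgn_insert hk,
      show x - Pi.single j 1 - Pi.single k 1 = x - Pi.single k 1 - Pi.single j (1 : ℤ) by abel]
    rcases sgn_eq_or (R := R) S j with h1 | h1 <;> rcases sgn_eq_or (R := R) S k with h2 | h2 <;>
      rcases lt_or_gt_of_ne hkj with h | h <;>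
      · rw [h1, h2]
        simp only [h, h.not_gt, if_true, if_false]
        simp only [one_mul, neg_mul, neg_neg]
        abel
  · rintro ⟨j, k⟩ hjk _ h
    simp only [Finset.mem_sigma, Finset.mem_compl, Finset.mem_insert, not_or] at hjk
    exact hjk.2.1 (congrArg Sigma.fst h)
  · rintro ⟨j, k⟩ hjk
    simp only [Finset.mem_sigma, Finset.mem_compl, Finset.mem_insert, not_or] at hjk ⊢
    exact ⟨hjk.2.2, Ne.symm hjk.2.1, hjk.1⟩
  · rintro ⟨j, k⟩ _
    rfl

theorem augmentation_cellBoundary (α : Cell d →₀ R) :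
    Finsupp.linearCombination R (fun _ : Cell d => (1 : R)) (cellBoundary R d α) = 0 := by
  induction α using Finsupp.induction_linear with
  | zero => simp
  | add f g hf hg => rw [map_add, map_add, hf, hg, add_zero]
  | single σ c =>
    unfold cellBoundary
    simp [Finsupp.linearCombination_single, map_sum]

/-! ### Top-dimensional chains and cycles of codimension one -/

/-- The boundary of the chain of top-dimensional cells with the given coefficients. -/
def topBoundary (R : Type*) [Ring R] (d : ℕ) : (Vertex d →₀ R) →ₗ[R] (Cell d →₀ R) :=
  cellBoundary R d ∘ₗ Finsupp.lmapDomain R R fun x => (x, Finset.univ)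

theorem topChain_apply (β : Vertex d →₀ R) (x : Vertex d) (S : Finset (Fin d)) :
    Finsupp.lmapDomain R R (fun x => ((x, Finset.univ) : Cell d)) β (x, S)
      = if S = Finset.univ then β x else 0 := by
  rw [Finsupp.lmapDomain_apply]
  split_ifs with h
  · subst h
    exact Finsupp.mapDomain_apply (fun a b h => (Prod.ext_iff.1 h).1) β x
  · refine Finsupp.mapDomain_of_notMem_range _ _ ?_
    rintro ⟨y, hy⟩
    exact h (Prod.ext_iff.1 hy).2.symm

/-- A plaquette separates exactly two d-cells, so the boundary of a top chain is a signed gradient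
of its coefficient function along dual edges. -/
theorem topBoundary_erase (β : Vertex d →₀ R) (x : Vertex d) (j : Fin d) :
    topBoundary R d β (x, Finset.univ.erase j)
      = sgn R (Finset.univ.erase j) j * (β (x - Pi.single j 1) - β x) := by
  unfold topBoundary
  rw [LinearMap.comp_apply, cellBoundary_apply]
  have : (Finset.univ.erase j)ᶜ = {j} := by ext; simp
  rw [this, Finset.sum_singleton, topChain_apply, topChain_apply, Finset.insert_erase (by simp),
    if_pos rfl, if_pos rfl]

theorem exists_erase_of_card {S : Finset (Fin d)} (hd : 1 ≤ d) (hS : S.card = d - 1) :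
    ∃ j, S = Finset.univ.erase j := by
  have h1 : Sᶜ.card = 1 := by
    rw [Finset.card_compl, hS, Fintype.card_fin]
    omega
  obtain ⟨j, hj⟩ := Finset.card_eq_one.1 h1
  refine ⟨j, ?_⟩
  rw [← compl_compl S, hj]
  ext; simp

theorem topBoundary_of_card_ne (β : Vertex d →₀ R) {x : Vertex d} {S : Finset (Fin d)}
    (hS : S.card ≠ d - 1) : topBoundary R d β (x, S) = 0 := by
  unfold topBoundary
  rw [LinearMap.comp_apply, cellBoundary_apply]
  refine Finset.sum_eq_zero fun j hj => ?_
  have : insert j S ≠ Finset.univ := by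
    intro h
    have h1 := congrArg Finset.card h
    rw [Finset.card_insert_of_notMem (Finset.mem_compl.1 hj), Finset.card_univ,
      Fintype.card_fin] at h1
    omega
  rw [topChain_apply, topChain_apply, if_neg this, if_neg this, sub_zero, mul_zero]

theorem cellBoundary_topBoundary (β : Vertex d →₀ R) :
    cellBoundary R d (topBoundary R d β) = 0 := cellBoundary_cellBoundary _

/-- A discrete closed `1`-form with support in a box is the differential of a function with support
in the box. -/
theorem exists_potential {A : Type*} [AddCommGroup A] (hd : 2 ≤ d) {N : ℕ}
    {a : Fin d → Vertex d → A}
    (hclosed : ∀ j k x, a k (x - Pi.single j 1) - a k x = a j (x - Pi.single k 1) - a j x)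
    (hlow : ∀ j (x : Vertex d) m, x m < -(N : ℤ) → a j x = 0)
    (hhigh : ∀ j (x : Vertex d) m, m ≠ j → (N : ℤ) ≤ x m → a j x = 0) :
    ∃ h : Vertex d → A, (∀ x ∉ box d (-N) (N - 1), h x = 0) ∧
      ∀ j x, h (x - Pi.single j 1) - h x = a j x := by
  let o : Fin d := ⟨0, by omega⟩
  -- The form is summed along direction o from height -N up to x; `toNat` makes the sum empty below
  -- the box. The minus sign fits the backward differences.
  let h : Vertex d → A := fun x =>
    -∑ i ∈ Finset.range (x o + N + 1).toNat, a o (x - (i : ℤ) • Pi.single o 1)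
  have ho : ∀ x, h (x - Pi.single o 1) - h x = a o x := by
    intro x
    have hxo : (x - Pi.single o 1 : Vertex d) o = x o - 1 := by simp
    simp only [h, hxo]
    by_cases hx : x o < -N
    · rw [hlow o x o hx, Int.toNat_of_nonpos (by omega), Int.toNat_of_nonpos (by omega)]
      simp
    · obtain ⟨m, hm⟩ := Int.eq_ofNat_of_zero_le (show 0 ≤ x o + N by omega)
      rw [show (x o + N + 1).toNat = m + 1 by omega,
        show (x o - 1 + N + 1).toNat = m by omega,
        Finset.sum_range_succ']
      have : ∀ i : ℕ, x - ((i + 1 : ℕ) : ℤ) • (Pi.single o 1 : Vertex d)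
          = x - Pi.single o 1 - (i : ℤ) • Pi.single o 1 := by
        intro i
        push_cast
        rw [add_smul, one_smul]
        abel
      simp only [this]
      simp
  have hbelow : ∀ x : Vertex d, x o < -N → h x = 0 := by
    intro x hx
    simp only [h]
    rw [Int.toNat_of_nonpos (by omega)]
    simp
  have hall : ∀ j x, h (x - Pi.single j 1) - h x = a j x := by
    intro j
    by_cases hj : j = o
    · subst hj; exact ho
    -- Closedness makes the error h(x - e_j) - h(x) - a_j(x) invariant under steps along o, and the
    -- error vanishes below the box.
    have key : ∀ n : ℕ, ∀ x : Vertex d, x o < -N + n →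
        h (x - Pi.single j 1) - h x = a j x := by
      intro n
      induction n with
      | zero =>
        intro x hx
        have hx : x o < -N := by simpa using hx
        have hx' : (x - Pi.single j 1 : Vertex d) o < -N := by
          simpa [Pi.single_eq_of_ne' hj] using hx
        rw [hbelow _ hx, hbelow _ hx', hlow j x o hx, sub_zero]
      | succ n ih =>
        intro x hx
        have h1 := ih (x - Pi.single o 1) (by push_cast at hx; simp; omega)
        have h2 := ho x
        have h3 := ho (x - Pi.single j 1)
        have h4 := hclosed o j x
        rw [show x - Pi.single j 1 - Pi.single o 1 = x - Pi.single o 1 - Pi.single j (1 : ℤ) by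
          abel] at h3
        rw [← h3, ← h2, sub_eq_iff_eq_add] at h4
        rw [h4] at h1
        rw [← sub_eq_zero] at h1 ⊢
        rw [← h1]
        abel
    intro x
    exact key (x o + N + 1).toNat x (by omega)
  refine ⟨h, fun x hx => ?_, hall⟩
  obtain ⟨m, hm⟩ : ∃ m, x m < -N ∨ N ≤ x m := by
    by_contra! hcon
    refine hx (mem_box.2 fun m => ?_)
    have := hcon m
    omega
  have hside : ∀ y : Vertex d, ∀ i, i ≠ o → (y i < -N ∨ N ≤ y i) → h y = 0 := by
    intro y i hi hy
    simp only [h]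
    rw [neg_eq_zero]
    refine Finset.sum_eq_zero fun t _ => ?_
    have : (y - (t : ℤ) • (Pi.single o 1 : Vertex d)) i = y i := by
      simp [hi]
    rcases hy with hy | hy
    · exact hlow o _ i (by rw [this]; exact hy)
    · exact hhigh o _ i hi (by rw [this]; exact hy)
  by_cases hmo : m = o
  · subst hmo
    rcases hm with hm | hm
    · exact hbelow x hm
    · have : Nontrivial (Fin d) := Fin.nontrivial_iff_two_le.2 hd
      obtain ⟨j, hj⟩ := exists_ne o
      -- At or above height N the component `a j` vanishes, so h does not change in direction j.
      -- Moving far enough along -e_j leaves the box sideways, where h is known to be zero.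
      have hconst : ∀ n : ℕ, h (x - (n : ℤ) • (Pi.single j 1 : Vertex d)) = h x := by
        intro n
        induction n with
        | zero => simp
        | succ n ih =>
          rw [← ih]
          have h1 := hall j (x - (n : ℤ) • (Pi.single j 1 : Vertex d))
          rw [hhigh j _ o hj.symm (by simpa [Pi.single_eq_of_ne' hj] using hm),
            sub_eq_zero] at h1
          rw [← h1]
          congr 1
          push_cast
          rw [add_smul, one_smul]
          abel
      rw [← hconst (x j + N + 1).toNat]
      refine hside _ j hj (Or.inl ?_)
      simp
      omega
  · exact hside x m hmo hm

/-- The homology of the box vanishes in codimension one. -/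
theorem exists_topBoundary_eq (hd : 2 ≤ d) {N : ℕ} {α : Cell d →₀ R}
    (hα : ∀ σ, α σ ≠ 0 → InBox N σ ∧ σ.2.card = d - 1) (hcycle : cellBoundary R d α = 0) :
    ∃ β : Vertex d →₀ R, (∀ x ∉ box d (-N) (N - 1), β x = 0) ∧ topBoundary R d β = α := by
  obtain ⟨h, h0, hh⟩ : ∃ h : Vertex d → R, (∀ x ∉ box d (-N) (N - 1), h x = 0) ∧
      ∀ j x, h (x - Pi.single j 1) - h x
        = sgn R (Finset.univ.erase j) j * α (x, Finset.univ.erase j) := by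
    -- The signs turn the cycle condition at a cell S of codimension two into closedness for the two
    -- directions missing from S.
    refine exists_potential hd (N := N) ?_ ?_ ?_
    · intro j k x
      by_cases hjk : j = k
      · subst hjk; rfl
      set S := (Finset.univ.erase j).erase k with hS
      have hkS : k ∉ S := Finset.notMem_erase _ _
      have hjS : j ∉ S := by simp [hS]
      have h1 : insert k S = Finset.univ.erase j :=
        Finset.insert_erase (Finset.mem_erase.2 ⟨Ne.symm hjk, Finset.mem_univ _⟩)
      have h2 : insert j S = Finset.univ.erase k := by
        rw [hS, Finset.erase_right_comm,
          Finset.insert_erase (Finset.mem_erase.2 ⟨hjk, Finset.mem_univ _⟩)]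
      have h3 : Sᶜ = {j, k} := by
        ext i
        simp only [hS, Finset.mem_compl, Finset.mem_erase, Finset.mem_univ, Finset.mem_insert,
          Finset.mem_singleton, and_true]
        tauto
      have h4 := cellBoundary_apply α x S
      rw [hcycle, Finsupp.zero_apply, h3, Finset.sum_pair hjk, h1, h2] at h4
      rw [← h1, ← h2, sgn_insert hkS, sgn_insert hjS, h1, h2]
      rcases sgn_eq_or (R := R) S j with e1 | e1 <;> rcases sgn_eq_or (R := R) S k with e2 | e2 <;>
        rcases lt_or_gt_of_ne hjk with h | h <;>
        · rw [e1, e2] at h4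
          rw [e1, e2]
          simp only [h, h.not_gt, if_true, if_false]
          simp only [one_mul, neg_mul, neg_neg] at h4 ⊢
          first
          | rw [← sub_eq_zero]; refine Eq.trans ?_ h4.symm; abel1
          | rw [← sub_eq_zero, ← neg_eq_zero]; refine Eq.trans ?_ h4.symm; abel1
    · intro j x m hm
      by_contra hne
      have := ((hα _ (right_ne_zero_of_mul hne)).1 m).1
      simp only at this
      omega
    · intro j x m hmj hm
      by_contra hne
      have := ((hα _ (right_ne_zero_of_mul hne)).1 m).2
      simp only [Finset.mem_erase, Finset.mem_univ, and_true] at this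
      rw [if_pos hmj] at this
      omega
  have hfin : (Function.support h).Finite := (box d (-N) (N - 1)).finite_toSet.subset
    fun x hx => by
      by_contra hx'
      exact hx (h0 x hx')
  refine ⟨Finsupp.ofSupportFinite h hfin, h0, ?_⟩
  ext ⟨x, S⟩
  by_cases hS : S.card = d - 1
  · obtain ⟨j, rfl⟩ := exists_erase_of_card (by omega) hS
    rw [topBoundary_erase]
    change sgn R _ _ * (h _ - h _) = _
    rw [hh, ← mul_assoc, sgn_mul_self, one_mul]
  · rw [topBoundary_of_card_ne _ hS]
    by_contra hne
    exact hS (hα _ (Ne.symm hne)).2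

/-- A function with zero boundary is invariant under translation by a coordinate vector, which
finite support allows only for zero. -/
theorem topBoundary_injective (hd : 1 ≤ d) : Function.Injective (topBoundary R d) := by
  rw [injective_iff_map_eq_zero]
  intro β hβ
  let o : Fin d := ⟨0, by omega⟩
  have h1 : ∀ x, β (x - Pi.single o 1) = β x := by
    intro x
    have h2 := topBoundary_erase β x o
    rw [hβ, Finsupp.zero_apply] at h2
    have h3 := congrArg (sgn R (Finset.univ.erase o) o * ·) h2
    simp only [mul_zero] at h3
    rw [← mul_assoc, sgn_mul_self, one_mul] at h3
    exact sub_eq_zero.1 h3.symm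
  ext x
  by_contra hx
  have h2 : ∀ n : ℕ, β (x - (n : ℤ) • (Pi.single o 1 : Vertex d)) = β x := by
    intro n
    induction n with
    | zero => simp
    | succ n ih =>
      rw [← ih, ← h1 (x - (n : ℤ) • (Pi.single o 1 : Vertex d))]
      congr 1
      push_cast
      rw [add_smul, one_smul]
      abel
  refine Set.infinite_of_injective_forall_mem
    (f := fun n : ℕ => x - (n : ℤ) • (Pi.single o 1 : Vertex d)) ?_ ?_ β.hasFiniteSupport
  · intro m n hmn
    have := congrFun hmn o
    simpa using this
  · intro n
    rw [Function.mem_support, h2]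
    exact hx

end Homology

/-! ### Duality for the plaquette random-cluster model with free boundary conditions -/

section Duality

variable {d : ℕ} {R : Type*} [Ring R]

/-- With d-cells indexed by their lowest corners, the criterion is that the d-cells on both sides of
the plaquette lie in Λ_N. -/
theorem mem_boxPlaquettes {N : ℕ} {σ : Plaquette d} :
    σ ∈ boxPlaquettes d N ↔
      σ.1 - Pi.single σ.2 1 ∈ box d (-N) (N - 1) ∧ σ.1 ∈ box d (-N) (N - 1) := by
  obtain ⟨x, j⟩ := σ
  have hσ : (x, j) ∈ boxPlaquettes d N ↔
      InBox N (plaqCell (x, j)) ∧ ¬ InBoxBoundary N (plaqCell (x, j)) := by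
    unfold boxPlaquettes
    simp only [Finset.mem_filter, Finset.mem_product, Finset.mem_univ, and_true,
      and_iff_right_iff_imp]
    rintro ⟨h, -⟩
    refine Finset.mem_Icc.2 ⟨fun m => (h m).1, fun m => ?_⟩
    have := (h m).2
    simp only [plaqCell] at this
    split_ifs at this <;> simp only <;> omega
  rw [hσ, mem_box, mem_box]
  unfold InBoxBoundary InBox plaqCell
  simp only [Finset.mem_erase, Finset.mem_univ, and_true, not_not, Pi.sub_apply]
  constructor
  · rintro ⟨h1, h2⟩
    have h3 : x j ≠ -N ∧ x j ≠ N := by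
      by_contra h
      exact h2 ⟨h1, j, rfl, by tauto⟩
    have h4 : ∀ m, -(N : ℤ) ≤ x m ∧ x m ≤ N - 1 := by
      intro m
      have := h1 m
      by_cases hm : m = j
      · subst hm; rw [if_neg (by simp)] at this; omega
      · rw [if_pos hm] at this; omega
    refine ⟨fun m => ?_, h4⟩
    have := h4 m
    by_cases hm : m = j
    · subst hm; rw [Pi.single_eq_same]; omega
    · rw [Pi.single_eq_of_ne hm]; omega
  · rintro ⟨h1, h2⟩
    refine ⟨fun m => ?_, ?_⟩
    · have := h2 m
      split_ifs <;> omega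
    · rintro ⟨-, m, rfl, hm⟩
      have h3 := h1 m
      have h4 := h2 m
      rw [Pi.single_eq_same] at h3
      omega

theorem tip_dualEdge (σ : Plaquette d) : tip (dualEdge σ) = σ.1 := by simp [tip, dualEdge]

theorem dualEdge_injective : Function.Injective (dualEdge (d := d)) := by
  rintro ⟨x, i⟩ ⟨y, j⟩ h
  obtain rfl : i = j := congrArg Prod.snd h
  have := congrArg Prod.fst h
  simpa [dualEdge] using this

theorem plaqCell_injective : Function.Injective (plaqCell (d := d)) := by
  rintro ⟨x, i⟩ ⟨y, j⟩ h
  obtain rfl : x = y := congrArg Prod.fst h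
  have h2 : Finset.univ.erase i = Finset.univ.erase j := congrArg Prod.snd h
  have : i ∉ Finset.univ.erase j := h2 ▸ Finset.notMem_erase i _
  simp at this
  rw [this]

theorem card_plaqCell (σ : Plaquette d) : (plaqCell σ).2.card = d - 1 := by
  simp [plaqCell]

theorem dualEdge_mem_dualBoxEdges {N : ℕ} {σ : Plaquette d} :
    dualEdge σ ∈ dualBoxEdges d N ↔ σ ∈ boxPlaquettes d N := by
  rw [mem_dualBoxEdges, mem_boxPlaquettes, tip_dualEdge]
  rfl

theorem image_dualEdge_boxPlaquettes (d N : ℕ) :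
    (boxPlaquettes d N).image dualEdge = dualBoxEdges d N := by
  ext b
  rw [Finset.mem_image]
  constructor
  · rintro ⟨σ, hσ, rfl⟩
    exact dualEdge_mem_dualBoxEdges.2 hσ
  · intro hb
    have : dualEdge (tip b, b.2) = b := by simp [dualEdge, tip]
    exact ⟨(tip b, b.2), dualEdge_mem_dualBoxEdges.1 (this.symm ▸ hb), this⟩

/-- The dual edges of the closed plaquettes. -/
def dualConfig (N : ℕ) (P : Finset (Plaquette d)) : Finset (Edge d) :=
  (boxPlaquettes d N \ P).image dualEdge

theorem forall_mem_dualConfig {N : ℕ} {P : Finset (Plaquette d)} {p : Vertex d → Vertex d → Prop} :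
    (∀ b ∈ dualConfig N P, p b.1 (tip b)) ↔
      ∀ σ ∈ boxPlaquettes d N, σ ∉ P → p (σ.1 - Pi.single σ.2 1) σ.1 := by
  unfold dualConfig
  simp only [Finset.forall_mem_image, Finset.mem_sdiff, tip_dualEdge, and_imp]
  rfl

/-! ### Chains of the percolation complex -/

theorem mem_chains {X : Set (Cell d)} {k : ℕ} {α : Cell d →₀ R} :
    α ∈ chains R X k ↔ ∀ σ, α σ ≠ 0 → σ ∈ X ∧ σ.2.card = k := by
  unfold chains
  rw [Finsupp.mem_supported]
  simp only [Set.subset_def, Finset.mem_coe, Finsupp.mem_support_iff]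
  rfl

theorem mem_percComplex_iff_of_card (hd : 2 ≤ d) {N : ℕ} {P : Finset (Plaquette d)} {σ : Cell d}
    (hσ : σ.2.card = d - 1) : σ ∈ percComplex d N P ↔ σ ∈ plaqCell '' (P : Set (Plaquette d)) := by
  unfold percComplex
  rw [Set.mem_union]
  refine or_iff_right ?_
  rintro ⟨-, h⟩
  omega

theorem mem_chains_percComplex (hd : 2 ≤ d) {N : ℕ} {P : Finset (Plaquette d)} {α : Cell d →₀ R} :
    α ∈ chains R (percComplex d N P) (d - 1) ↔
      (∀ x S, S.card ≠ d - 1 → α (x, S) = 0) ∧ ∀ σ ∉ P, α (plaqCell σ) = 0 := by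
  rw [mem_chains]
  constructor
  · refine fun h => ⟨fun x S hS => ?_, fun σ hσ => ?_⟩
    · by_contra hne
      exact hS (h _ hne).2
    · by_contra hne
      obtain ⟨τ, hτ, h2⟩ := (mem_percComplex_iff_of_card hd (card_plaqCell σ)).1 (h _ hne).1
      exact hσ (plaqCell_injective h2 ▸ hτ)
  · rintro ⟨h1, h2⟩ ⟨x, S⟩ hne
    have hS : S.card = d - 1 := by
      by_contra hS
      exact hne (h1 x S hS)
    refine ⟨(mem_percComplex_iff_of_card hd hS).2 ?_, hS⟩
    obtain ⟨j, rfl⟩ := exists_erase_of_card (by omega) hS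
    refine ⟨(x, j), ?_, rfl⟩
    by_contra hP
    exact hne (h2 (x, j) hP)

theorem topBoundary_plaqCell (β : Vertex d →₀ R) (σ : Plaquette d) :
    topBoundary R d β (plaqCell σ)
      = sgn R (Finset.univ.erase σ.2) σ.2 * (β (σ.1 - Pi.single σ.2 1) - β σ.1) :=
  topBoundary_erase β σ.1 σ.2

theorem sgn_mul_eq_zero {S : Finset (Fin d)} {j : Fin d} {a : R} : sgn R S j * a = 0 ↔ a = 0 := by
  rcases sgn_eq_or (R := R) S j with h | h <;> simp [h]

theorem topBoundary_plaqCell_eq_zero {N : ℕ} {β : Vertex d →₀ R}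
    (hβ : ∀ x ∉ box d (1 - N) (N - 2), β x = 0) {σ : Plaquette d} (hσ : σ ∉ boxPlaquettes d N) :
    topBoundary R d β (plaqCell σ) = 0 := by
  have h : ¬ (dualEdge σ ∈ touchingEdges (box d (1 - N) (N - 2))) := fun h =>
    hσ (dualEdge_mem_dualBoxEdges.1 (touchingEdges_subset_dualBoxEdges N h))
  rw [mem_touchingEdges, tip_dualEdge, not_or] at h
  rw [topBoundary_plaqCell, hβ (σ.1 - Pi.single σ.2 1) h.1, hβ _ h.2, sub_zero, mul_zero]

/-- A d-cell in the outermost layer has a face on ∂Λ_N, beyond which β is zero. The boundary has no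
mass on that face, so β is zero on the cell as well. This is how free plaquette boundary conditions
become wired dual ones. -/
theorem eq_zero_of_topBoundary_plaqCell {N : ℕ} {β : Vertex d →₀ R}
    (hβ : ∀ x ∉ box d (-N) (N - 1), β x = 0)
    (h : ∀ σ ∉ boxPlaquettes d N, topBoundary R d β (plaqCell σ) = 0) :
    ∀ x ∉ box d (1 - N) (N - 2), β x = 0 := by
  intro x hx
  by_cases hxD : x ∈ box d (-N) (N - 1)
  · obtain ⟨m, hm⟩ : ∃ m, x m = -N ∨ x m = N - 1 := by
      by_contra! hcon
      refine hx (mem_box.2 fun m => ?_)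
      have := hcon m
      have := mem_box.1 hxD m
      omega
    rcases hm with hm | hm
    · have hout : x - Pi.single m 1 ∉ box d (-N) (N - 1) := by
        intro h'
        have := (mem_box.1 h' m).1
        rw [Pi.sub_apply, Pi.single_eq_same] at this
        omega
      have h1 := h (x, m) fun h' => hout (mem_boxPlaquettes.1 h').1
      rw [topBoundary_plaqCell, sgn_mul_eq_zero, hβ _ hout, zero_sub, neg_eq_zero] at h1
      exact h1
    · have hout : x + Pi.single m 1 ∉ box d (-N) (N - 1) := by
        intro h'
        have := (mem_box.1 h' m).2
        rw [Pi.add_apply, Pi.single_eq_same] at this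
        omega
      have h1 := h (x + Pi.single m 1, m) fun h' => hout (mem_boxPlaquettes.1 h').2
      rw [topBoundary_plaqCell, sgn_mul_eq_zero, hβ _ hout, sub_zero, add_sub_cancel_right] at h1
      exact h1
  · exact hβ x hxD

theorem inBox_plaqCell_of_mem {N : ℕ} {σ : Plaquette d} (hσ : σ ∈ boxPlaquettes d N) :
    InBox N (plaqCell σ) := by
  unfold boxPlaquettes at hσ
  simp only [Finset.mem_filter] at hσ
  exact hσ.2.1

/-- The cycles of codimension one that are carried by the plaquettes of `Λ_N` away from the
boundary. -/
theorem exists_topBoundary_eq_of_cycle (hd : 2 ≤ d) {N : ℕ} {α : Cell d →₀ R}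
    (hα : α ∈ chains R (percComplex d N (boxPlaquettes d N)) (d - 1))
    (hcycle : cellBoundary R d α = 0) :
    ∃ β : Vertex d →₀ R, (∀ x ∉ box d (1 - N) (N - 2), β x = 0) ∧ topBoundary R d β = α := by
  have hα' := hα
  rw [mem_chains] at hα'
  have hbox : ∀ σ, α σ ≠ 0 → InBox N σ ∧ σ.2.card = d - 1 := by
    intro σ hσ
    obtain ⟨h1, h2⟩ := hα' σ hσ
    obtain ⟨τ, hτ, rfl⟩ := (mem_percComplex_iff_of_card hd h2).1 h1
    exact ⟨inBox_plaqCell_of_mem hτ, h2⟩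
  obtain ⟨β, h1, h2⟩ := exists_topBoundary_eq hd hbox hcycle
  refine ⟨β, eq_zero_of_topBoundary_plaqCell h1 fun σ hσ => ?_, h2⟩
  rw [h2]
  exact ((mem_chains_percComplex hd).1 hα).2 σ hσ

/-- A cycle of codimension one is the gradient of a function on d-cells. It avoids a closed
plaquette exactly when that function agrees across the dual edge, that is, when it is constant on
dual clusters. -/
theorem map_clusterFns (hd : 2 ≤ d) {N : ℕ} {P : Finset (Plaquette d)}
    (hP : P ⊆ boxPlaquettes d N) :
    (clusterFns (box d (1 - N) (N - 2)) (dualConfig N P)).map (topBoundary ℚ d)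
      = chains ℚ (percComplex d N P) (d - 1) ⊓ LinearMap.ker (cellBoundary ℚ d) := by
  have hiff : ∀ β : Vertex d →₀ ℚ, (∀ x ∉ box d (1 - N) (N - 2), β x = 0) →
      ((∀ b ∈ dualConfig N P, β b.1 = β (tip b)) ↔
        ∀ σ ∉ P, topBoundary ℚ d β (plaqCell σ) = 0) := by
    intro β hβ
    rw [forall_mem_dualConfig (p := fun x y => β x = β y)]
    refine ⟨fun h σ hσ => ?_, fun h σ _ hσP => ?_⟩
    · by_cases hσE : σ ∈ boxPlaquettes d N
      · rw [topBoundary_plaqCell, sgn_mul_eq_zero, sub_eq_zero]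
        exact h σ hσE hσ
      · exact topBoundary_plaqCell_eq_zero hβ hσE
    · have := h σ hσP
      rwa [topBoundary_plaqCell, sgn_mul_eq_zero, sub_eq_zero] at this
  ext α
  rw [Submodule.mem_map, Submodule.mem_inf, LinearMap.mem_ker]
  constructor
  · rintro ⟨β, ⟨h1, h2⟩, rfl⟩
    exact ⟨(mem_chains_percComplex hd).2
      ⟨fun x S hS => topBoundary_of_card_ne β hS, (hiff β h1).1 h2⟩, cellBoundary_topBoundary β⟩
  · rintro ⟨h1, h2⟩
    rw [mem_chains_percComplex hd] at h1
    obtain ⟨β, h3, rfl⟩ := exists_topBoundary_eq_of_cycle hd (N := N)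
      ((mem_chains_percComplex hd).2 ⟨h1.1, fun σ hσ => h1.2 σ fun h => hσ (hP h)⟩) h2
    exact ⟨β, ⟨h3, (hiff β h3).2 h1.2⟩, rfl⟩

/-! ### Betti numbers and dual cluster counts -/

theorem finrank_map_add_finrank_inf_ker {K V W : Type*} [Field K] [AddCommGroup V] [Module K V]
    [AddCommGroup W] [Module K W] (f : V →ₗ[K] W) (C : Submodule K V) [FiniteDimensional K C] :
    Module.finrank K (C.map f) + Module.finrank K (C ⊓ LinearMap.ker f : Submodule K V)
      = Module.finrank K C := by
  rw [← LinearMap.finrank_range_add_finrank_ker (f.domRestrict C), LinearMap.range_domRestrict]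
  congr 1
  have : (LinearMap.ker (f.domRestrict C)).map C.subtype = C ⊓ LinearMap.ker f := by
    ext x
    simp only [Submodule.mem_map, LinearMap.mem_ker, Submodule.mem_inf]
    constructor
    · rintro ⟨y, hy, rfl⟩
      exact ⟨y.2, hy⟩
    · rintro ⟨h1, h2⟩
      exact ⟨⟨x, h1⟩, h2, rfl⟩
  rw [← this, Submodule.finrank_map_subtype_eq]

theorem finrank_supported {K α : Type*} [Field K] (s : Set α) (hs : s.Finite) :
    Module.finrank K (Finsupp.supported K K s) = s.ncard := by
  have := hs.fintype
  rw [(Finsupp.supportedEquivFinsupp (M := K) (R := K) s).finrank_eq, Module.finrank_finsupp_self,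
    ← Nat.card_eq_fintype_card, Nat.card_coe_set_eq]

theorem chains_percComplex_eq (hd : 2 ≤ d) (N : ℕ) (P : Finset (Plaquette d)) :
    chains R (percComplex d N P) (d - 1)
      = Finsupp.supported R R (plaqCell '' (P : Set (Plaquette d))) := by
  unfold chains
  congr 1
  ext σ
  constructor
  · rintro ⟨h1, h2⟩
    exact (mem_percComplex_iff_of_card hd h2).1 h1
  · rintro ⟨τ, hτ, rfl⟩
    exact ⟨Or.inr ⟨τ, hτ, rfl⟩, card_plaqCell τ⟩

/-- Rank-nullity for ∂ on the chains of P: its kernel is the space of cycles, which `map_clusterFns`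
and the injectivity of `topBoundary` identify with `clusterFns`. -/
theorem finrank_boundaries_add (hd : 2 ≤ d) {N : ℕ} {P : Finset (Plaquette d)}
    (hP : P ⊆ boxPlaquettes d N) :
    Module.finrank ℚ (boundaries ℚ (percComplex d N P) (d - 2))
      + clusterRank (box d (1 - N) (N - 2)) (dualConfig N P) = P.card := by
  have hfin : (plaqCell '' (P : Set (Plaquette d))).Finite := P.finite_toSet.image _
  have hfd : FiniteDimensional ℚ (chains ℚ (percComplex d N P) (d - 1)) := by
    rw [chains_percComplex_eq hd]
    exact finiteDimensional_supported _ hfin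
  have h1 := finrank_map_add_finrank_inf_ker (cellBoundary ℚ d)
    (chains ℚ (percComplex d N P) (d - 1))
  have h2 : Module.finrank ℚ (chains ℚ (percComplex d N P) (d - 1)) = P.card := by
    rw [chains_percComplex_eq hd, finrank_supported _ hfin,
      Set.ncard_image_of_injective _ plaqCell_injective, Set.ncard_coe_finset]
  rw [← map_clusterFns hd hP, h2] at h1
  rw [← h1]
  unfold boundaries clusterRank
  rw [show d - 2 + 1 = d - 1 by omega]
  congr 1
  exact LinearEquiv.finrank_eq
    (Submodule.equivMapOfInjective _ (topBoundary_injective (by omega)) _)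

theorem chains_percComplex_codimTwo (hd : 2 ≤ d) (N : ℕ) (P : Finset (Plaquette d)) :
    chains R (percComplex d N P) (d - 2) = chains R {σ | InBox N σ} (d - 2) := by
  unfold chains
  congr 1
  ext σ
  constructor
  · rintro ⟨h1 | ⟨τ, -, rfl⟩, h2⟩
    · exact ⟨h1.1, h2⟩
    · rw [card_plaqCell] at h2
      omega
  · rintro ⟨h1, h2⟩
    exact ⟨Or.inl ⟨h1, h2.le⟩, h2⟩

/-- All cells of dimension at most d - 2 are always present, so the Betti number depends on P only
through the space of boundaries. -/
theorem reducedCycles_percComplex (hd : 2 ≤ d) (N : ℕ) (P : Finset (Plaquette d)) :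
    reducedCycles R (percComplex d N P) (d - 2) = reducedCycles R {σ | InBox N σ} (d - 2) := by
  unfold reducedCycles
  rw [chains_percComplex_codimTwo hd]

theorem inBox_of_inBox_insert {N : ℕ} {x : Vertex d} {S : Finset (Fin d)} {j : Fin d}
    (hj : j ∉ S) (h : InBox N ((x - Pi.single j 1, insert j S) : Cell d) ∨
      InBox N ((x, insert j S) : Cell d)) : InBox N ((x, S) : Cell d) := by
  intro m
  rcases h with h | h
  · have := h m
    simp only [Finset.mem_insert, Pi.sub_apply] at this ⊢
    by_cases hm : m = j
    · subst hm
      rw [Pi.single_eq_same, if_pos (Or.inl rfl)] at this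
      rw [if_neg hj]
      omega
    · simpa [hm] using this
  · have := h m
    simp only [Finset.mem_insert] at this ⊢
    split_ifs at this ⊢ <;> first | omega | tauto

theorem boundaries_le_reducedCycles (hd : 2 ≤ d) {N : ℕ} {P : Finset (Plaquette d)}
    (hP : P ⊆ boxPlaquettes d N) :
    boundaries R (percComplex d N P) (d - 2) ≤ reducedCycles R (percComplex d N P) (d - 2) := by
  rw [reducedCycles_percComplex hd]
  unfold boundaries
  rw [show d - 2 + 1 = d - 1 by omega]
  rintro _ ⟨α, hα, rfl⟩
  refine ⟨⟨?_, cellBoundary_cellBoundary α⟩, ?_⟩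
  · rw [SetLike.mem_coe, mem_chains]
    rintro ⟨x, S⟩ hne
    rw [cellBoundary_apply] at hne
    obtain ⟨j, hj, hne⟩ := Finset.exists_ne_zero_of_sum_ne_zero hne
    rw [Finset.mem_compl] at hj
    have hne := right_ne_zero_of_mul hne
    have hmem : ∀ y, α (y, insert j S) ≠ 0 → InBox N ((y, insert j S) : Cell d) ∧
        (insert j S).card = d - 1 := by
      intro y hy
      obtain ⟨h1, h2⟩ := mem_chains.1 hα _ hy
      obtain ⟨τ, hτ, h3⟩ := (mem_percComplex_iff_of_card hd h2).1 h1
      exact ⟨h3 ▸ inBox_plaqCell_of_mem (hP hτ), h2⟩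
    rw [Finset.card_insert_of_notMem hj] at hmem
    have : α (x - Pi.single j 1, insert j S) ≠ 0 ∨ α (x, insert j S) ≠ 0 := by
      by_contra! h
      exact hne (by rw [h.1, h.2, sub_zero])
    rcases this with h | h
    · have := hmem _ h
      exact ⟨inBox_of_inBox_insert hj (Or.inl this.1), by simp only; omega⟩
    · have := hmem _ h
      exact ⟨inBox_of_inBox_insert hj (Or.inr this.1), by simp only; omega⟩
  · split_ifs
    · exact augmentation_cellBoundary α
    · trivial

theorem finite_inBox (d N : ℕ) : {σ : Cell d | InBox N σ}.Finite := by
  refine ((boxVertices d N ×ˢ Finset.univ).finite_toSet).subset fun σ hσ => ?_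
  simp only [Finset.coe_product, Set.mem_prod, Finset.mem_coe, Finset.mem_univ, and_true]
  refine Finset.mem_Icc.2 ⟨fun m => (hσ m).1, fun m => ?_⟩
  have := (hσ m).2
  split_ifs at this <;> simp only <;> omega

/-- Alexander duality for Betti numbers, in the form needed for the plaquette random-cluster
model. -/
theorem reducedBetti_add_card (hd : 2 ≤ d) {N : ℕ} {P : Finset (Plaquette d)}
    (hP : P ⊆ boxPlaquettes d N) :
    reducedBetti (percComplex d N P) (d - 2) + P.card
      = Module.finrank ℚ (reducedCycles ℚ {σ : Cell d | InBox N σ} (d - 2))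
        + clusterRank (box d (1 - N) (N - 2)) (dualConfig N P) := by
  have h1 := finrank_boundaries_add hd hP
  have hle := boundaries_le_reducedCycles (R := ℚ) hd hP
  have hfd : FiniteDimensional ℚ (reducedCycles ℚ (percComplex d N P) (d - 2)) := by
    rw [reducedCycles_percComplex hd]
    have := finiteDimensional_supported (K := ℚ)
      {σ : Cell d | σ ∈ {σ : Cell d | InBox N σ} ∧ σ.2.card = d - 2}
      ((finite_inBox d N).subset fun σ hσ => hσ.1)
    refine Submodule.finiteDimensional_of_le
      (S₂ := Finsupp.supported ℚ ℚ {σ : Cell d | σ ∈ {σ : Cell d | InBox N σ} ∧ σ.2.card = d - 2}) ?_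
    exact inf_le_left.trans inf_le_left
  have h2 := Submodule.finrank_quotient_add_finrank
    ((boundaries ℚ (percComplex d N P) (d - 2)).submoduleOf
      (reducedCycles ℚ (percComplex d N P) (d - 2)))
  rw [(Submodule.submoduleOfEquivOfLe hle).finrank_eq] at h2
  unfold reducedBetti
  rw [← reducedCycles_percComplex hd N P]
  omega

/-! ### The Wilson loop event -/

theorem equatorDisc_plaqCell {N : ℕ} (e : Fin d) {σ : Plaquette d} (hσ : σ ∈ boxPlaquettes d N) :
    equatorDisc R d N e (plaqCell σ) = if σ.2 = e ∧ σ.1 e = 0 then 1 else 0 := by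
  classical
  unfold equatorDisc
  rw [Finsupp.finsetSum_apply]
  simp only [Finsupp.single_apply, plaqCell_injective.eq_iff]
  rw [Finset.sum_ite_eq']
  simp [hσ]

theorem equatorDisc_mem_chains (hd : 2 ≤ d) (N : ℕ) (e : Fin d) :
    equatorDisc R d N e ∈ chains R (percComplex d N (boxPlaquettes d N)) (d - 1) := by
  rw [chains_percComplex_eq hd]
  unfold equatorDisc
  refine Submodule.sum_mem _ fun σ hσ => Finsupp.single_mem_supported _ _ ⟨σ, ?_, rfl⟩
  exact (Finset.mem_filter.1 hσ).1

open Classical in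
/-- The jump of the indicator of the half-space across a plaquette. -/
theorem indicator_halfSpace_sub (e : Fin d) (x : Vertex d) (j : Fin d) :
    (if 0 ≤ (x - Pi.single j 1 : Vertex d) e then (1 : R) else 0) - (if 0 ≤ x e then 1 else 0)
      = -if j = e ∧ x e = 0 then 1 else 0 := by
  by_cases hj : j = e
  · subst hj
    rw [Pi.sub_apply, Pi.single_eq_same]
    rcases lt_trichotomy (x j) 0 with h | h | h
    · rw [if_neg (by omega), if_neg (by omega), if_neg (by omega)]; simp
    · rw [if_neg (by omega), if_pos (by omega), if_pos ⟨rfl, h⟩]; simp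
    · rw [if_pos (by omega), if_pos (by omega), if_neg (by omega)]; simp
  · rw [Pi.sub_apply, Pi.single_eq_of_ne' hj, sub_zero, sub_self]
    simp [hj]

variable [Nontrivial R]

/-- The loop is a boundary in `P` if and only if the dual configuration is crossed by an
interface. -/
theorem mem_loopBounds_iff (hd : 2 ≤ d) {N : ℕ} (e : Fin d) {P : Finset (Plaquette d)}
    (hP : P ⊆ boxPlaquettes d N) :
    P ∈ loopBounds R d N e ↔ dualConfig N P ∈ separated e (box d (1 - N) (N - 2)) := by
  classical
  set s : R := sgn R (Finset.univ.erase e) e with hs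
  have hs0 : s ≠ 0 := by
    rcases sgn_eq_or (R := R) (Finset.univ.erase e) e with h | h <;> simp [hs, h]
  -- At interior plaquettes the disc has the signed jumps of -s·H. Since H has infinite support it
  -- is not a chain, so it is carried along separately from `topBoundary`.
  let H : Vertex d → R := fun x => if 0 ≤ x e then 1 else 0
  have hdisc := (mem_chains_percComplex hd).1 (equatorDisc_mem_chains (R := R) hd N e)
  have hcoef : ∀ (β : Vertex d →₀ R), ∀ σ ∈ boxPlaquettes d N,
      equatorDisc R d N e (plaqCell σ) + topBoundary R d β (plaqCell σ)
        = sgn R (Finset.univ.erase σ.2) σ.2 *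
          ((β (σ.1 - Pi.single σ.2 1) - s * H (σ.1 - Pi.single σ.2 1))
            - (β σ.1 - s * H σ.1)) := by
    intro β σ hσ
    have h1 := indicator_halfSpace_sub (R := R) e σ.1 σ.2
    have h2 : (β (σ.1 - Pi.single σ.2 1) - s * H (σ.1 - Pi.single σ.2 1)) - (β σ.1 - s * H σ.1)
        = s * (if σ.2 = e ∧ σ.1 e = 0 then 1 else 0) + (β (σ.1 - Pi.single σ.2 1) - β σ.1) := by
      rw [← neg_neg (if σ.2 = e ∧ σ.1 e = 0 then (1 : R) else 0), ← h1, mul_neg, mul_sub]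
      simp only [H]
      abel
    rw [equatorDisc_plaqCell e hσ, topBoundary_plaqCell, h2, mul_add]
    congr 1
    split_ifs with h
    · rw [h.1, ← hs, mul_one, sgn_mul_self]
    · simp
  constructor
  · rintro ⟨α, hα, hαe⟩
    rw [SetLike.mem_coe, show d - 2 + 1 = d - 1 by omega, mem_chains_percComplex hd] at hα
    have hdiff : α - equatorDisc R d N e ∈
        chains R (percComplex d N (boxPlaquettes d N)) (d - 1) :=
      Submodule.sub_mem _
        ((mem_chains_percComplex hd).2 ⟨hα.1, fun σ hσ => hα.2 σ fun h => hσ (hP h)⟩)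
        (equatorDisc_mem_chains hd N e)
    obtain ⟨β, h1, h2⟩ := exists_topBoundary_eq_of_cycle hd hdiff
      (by rw [map_sub, hαe]; exact sub_self _)
    -- Across a closed plaquette α vanishes, so β - s·H has no jump and its nonvanishing set is not
    -- left. Outside the interior β = 0, and s ≠ 0 makes this set the half-space; nothing more is
    -- needed of R.
    refine ⟨{x | β x - s * H x ≠ 0}, fun x hx => ?_, ?_⟩
    · simp only [Set.mem_ofPred_eq, h1 x hx, H]
      split_ifs with h <;> simp [h, hs0]
    · rw [forall_mem_dualConfig (p := fun x y => x ∈ {x | β x - s * H x ≠ 0} ↔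
        y ∈ {x | β x - s * H x ≠ 0})]
      intro σ hσ hσP
      have h3 := hcoef β σ hσ
      rw [h2, Finsupp.sub_apply, hα.2 σ hσP, zero_sub, add_neg_cancel] at h3
      have h4 := sub_eq_zero.1 (sgn_mul_eq_zero.1 h3.symm)
      simp only [Set.mem_ofPred_eq, h4]
  · rintro ⟨U, hU1, hU2⟩
    rw [forall_mem_dualConfig (p := fun x y => x ∈ U ↔ y ∈ U)] at hU2
    -- This choice makes β - s·H equal to -s times the indicator of U, which does not jump across
    -- closed plaquettes. It is supported in the interior because U is the half-space outside.
    let g : Vertex d → R := fun x => s * H x - s * (if x ∈ U then 1 else 0)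
    have hg : ∀ x ∉ box d (1 - N) (N - 2), g x = 0 := by
      intro x hx
      simp only [g, H, hU1 x hx, sub_self]
    have hfin : (Function.support g).Finite := (box d (1 - N) (N - 2)).finite_toSet.subset
      fun x hx => by
        by_contra hx'
        exact hx (hg x hx')
    let β : Vertex d →₀ R := Finsupp.ofSupportFinite g hfin
    have hβ : ∀ x, β x = g x := fun x => rfl
    refine ⟨equatorDisc R d N e + topBoundary R d β, ?_, ?_⟩
    · rw [SetLike.mem_coe, show d - 2 + 1 = d - 1 by omega, mem_chains_percComplex hd]
      refine ⟨fun x S hS => ?_, fun σ hσ => ?_⟩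
      · rw [Finsupp.add_apply, hdisc.1 x S hS, topBoundary_of_card_ne β hS, add_zero]
      · rw [Finsupp.add_apply]
        by_cases hσE : σ ∈ boxPlaquettes d N
        · rw [hcoef β σ hσE, sgn_mul_eq_zero, hβ, hβ]
          simp only [g, hU2 σ hσE hσ]
          abel
        · rw [hdisc.2 σ hσE, topBoundary_plaqCell_eq_zero hg hσE, add_zero]
    · rw [map_add, cellBoundary_topBoundary, add_zero]
      rfl

/-- By `reducedBetti_add_card`, the Betti number is a constant plus the dual cluster count minus
|P|. The factor q^(-|P|) changes the odds p : (1 - p) of an open plaquette into p : (1 - p)q, which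
are the odds (1 - p*) : p* of a closed dual edge. -/
theorem prcmWeight_eq (hd : 2 ≤ d) {N : ℕ} {p q : ℝ} (hq : 0 < q)
    (hD : 0 < (1 - p) * q + p) {P : Finset (Plaquette d)} (hP : P ⊆ boxPlaquettes d N) :
    prcmWeight d N p q P
      = q ^ Module.finrank ℚ (reducedCycles ℚ {σ : Cell d | InBox N σ} (d - 2))
          * (((1 - p) * q + p) / q) ^ (boxPlaquettes d N).card
        * wiredWeight (dualParam p q) q (box d (1 - N) (N - 2)) (dualBoxEdges d N)
            (dualConfig N P) := by
  have h1 : (dualConfig N P).card = (boxPlaquettes d N).card - P.card := by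
    unfold dualConfig
    rw [Finset.card_image_of_injective _ dualEdge_injective, Finset.card_sdiff_of_subset hP]
  have h2 : (dualBoxEdges d N).card = (boxPlaquettes d N).card := by
    rw [← image_dualEdge_boxPlaquettes, Finset.card_image_of_injective _ dualEdge_injective]
  obtain ⟨m, hm⟩ := Nat.exists_eq_add_of_le (Finset.card_le_card hP)
  have h3 : 1 - dualParam p q = p / ((1 - p) * q + p) := by
    unfold dualParam
    field_simp
    ring
  have h4 := congrArg (q ^ ·) (reducedBetti_add_card hd hP)
  simp only [pow_add] at h4
  unfold prcmWeight wiredWeight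
  rw [h1, h2, h3, hm, Nat.add_sub_cancel_left, Nat.add_sub_cancel, pow_add]
  unfold dualParam
  have hq' : q ^ P.card ≠ 0 := by positivity
  rw [eq_div_of_mul_eq hq' h4]
  simp only [div_pow, mul_pow]
  field_simp

/-- Taking dual configurations is a bijection that matches weights and events. The right side does
not involve R, which gives independence of the coefficient ring. -/
theorem prcmFreeProb_loopBounds (hd : 2 ≤ d) (N : ℕ) (e : Fin d) {p q : ℝ} (hq : 0 < q)
    (hD : 0 < (1 - p) * q + p) :
    prcmFreeProb d N p q (loopBounds R d N e) = dualBoxSepProb d e (dualParam p q) q N := by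
  classical
  unfold prcmFreeProb dualBoxSepProb sepProb
  refine gibbsProb_congr (c := q ^ Module.finrank ℚ
      (reducedCycles ℚ {σ : Cell d | InBox N σ} (d - 2))
      * (((1 - p) * q + p) / q) ^ (boxPlaquettes d N).card) (by positivity)
    (dualConfig N) (fun Q => (boxPlaquettes d N).filter (dualEdge · ∉ Q)) ?_ ?_ ?_ ?_
    (fun P hP => prcmWeight_eq hd hq hD hP) fun P hP => mem_loopBounds_iff hd e hP
  · intro P _
    rw [← image_dualEdge_boxPlaquettes]
    exact Finset.image_subset_image Finset.sdiff_subset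
  · exact fun Q _ => Finset.filter_subset _ _
  · intro P hP
    ext σ
    simp only [Finset.mem_filter, dualConfig, dualEdge_injective.mem_finset_image,
      Finset.mem_sdiff]
    have := @hP σ
    tauto
  · intro Q hQ
    ext b
    simp only [dualConfig, Finset.mem_image, Finset.mem_sdiff, Finset.mem_filter, not_and, not_not]
    constructor
    · rintro ⟨σ, ⟨h1, h2⟩, rfl⟩
      exact h2 h1
    · intro hb
      have := hQ hb
      rw [← image_dualEdge_boxPlaquettes, Finset.mem_image] at this
      obtain ⟨σ, hσ, rfl⟩ := this
      exact ⟨σ, ⟨hσ, fun _ => hb⟩, rfl⟩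

end Duality

/-! ### The tensions -/

section Tension

variable {d : ℕ}

theorem decayRate_of_pos (d N : ℕ) {P : ℝ} (hP : 0 < P) :
    decayRate d N P = ((-Real.log P / (2 * (N : ℝ)) ^ (d - 1) : ℝ) : EReal) := by
  unfold decayRate
  rw [ENNReal.log_ofReal_of_pos hP, EReal.coe_div, EReal.coe_neg]

theorem decayRate_zero (d : ℕ) {N : ℕ} (hN : 1 ≤ N) : decayRate d N 0 = ⊤ := by
  unfold decayRate
  rw [ENNReal.ofReal_zero, ENNReal.log_zero, EReal.neg_bot]
  have hN' : (0 : ℝ) < N := by exact_mod_cast hN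
  refine EReal.top_div_of_pos_ne_top ?_ (EReal.coe_ne_top _)
  exact_mod_cast (by positivity : (0 : ℝ) < (2 * (N : ℝ)) ^ (d - 1))

theorem tendsto_decayRate {P : ℕ → ℝ} {L : ℝ} (hP : ∀ N, 1 ≤ N → 0 < P N)
    (h : Tendsto (fun N : ℕ => -Real.log (P N) / (2 * (N : ℝ)) ^ (d - 1)) atTop (𝓝 L)) :
    Tendsto (fun N : ℕ => decayRate d N (P N)) atTop (𝓝 (L : EReal)) := by
  refine ((continuous_coe_real_ereal.tendsto L).comp h).congr' ?_
  filter_upwards [eventually_ge_atTop 1] with N hN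
  exact (decayRate_of_pos d N (hP N hN)).symm

/-- With every edge closed, the half-space itself is an interface. -/
theorem sepProb_pos {p q : ℝ} (hp0 : 0 ≤ p) (hp1 : p < 1) (hq : 1 ≤ q) (e : Fin d)
    (I : Finset (Vertex d)) (E : Finset (Edge d)) : 0 < sepProb p q e I E := by
  have h1 : 0 < 1 - p := by linarith
  refine (pow_pos h1 E.card).trans_le ((pow_le_gibbsProb_disjoint hp0 hp1 hq I E E).trans ?_)
  refine gibbsProb_mono (isFKGWeight_wiredWeight hp0 hp1 hq I E).nonneg fun Q hQ hQE => ?_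
  have : Q = ∅ := by
    rw [Set.mem_ofPred_eq] at hQE
    rw [← Finset.inter_eq_left.2 hQ]
    exact Finset.disjoint_iff_inter_eq_empty.1 hQE
  subst this
  exact ⟨{x | 0 ≤ x e}, fun _ _ => Iff.rfl, by simp⟩

theorem gibbsProb_wiredWeight_one (q : ℝ) (I : Finset (Vertex d)) {E : Finset (Edge d)}
    {A : Set (Finset (Edge d))} (hE : E ∉ A) : gibbsProb E (wiredWeight 1 q I E) A = 0 := by
  classical
  rw [gibbsProb_eq, Finset.sum_eq_zero, zero_div]
  intro Q hQ
  rw [Finset.mem_filter, Finset.mem_powerset] at hQ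
  have hne : Q ≠ E := fun h => hE (h ▸ hQ.2)
  have hlt := Finset.card_lt_card (lt_of_le_of_ne hQ.1 hne)
  unfold wiredWeight
  rw [sub_self, zero_pow (by omega), mul_zero, zero_mul]

/-- A vertical edge in the outer layer, from height -1 to height 0, has both ends outside the
interior, where the interface is prescribed to separate them. Another coordinate, fixed at -N,
places it in that layer; this is where d ≥ 2 enters. -/
theorem dualBoxEdges_notMem_separated (hd : 2 ≤ d) (e : Fin d) {N : ℕ} (hN : 1 ≤ N) :
    dualBoxEdges d N ∉ separated e (box d (1 - N) (N - 2)) := by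
  rintro ⟨U, h1, h2⟩
  have : Nontrivial (Fin d) := Fin.nontrivial_iff_two_le.2 hd
  obtain ⟨j, hj⟩ := exists_ne e
  let x : Vertex d := fun i => if i = e then -1 else -N
  have hxe : x e = -1 := by simp [x]
  have hte : tip (x, e) e = 0 := by simp [tip, hxe]
  have hx : ∀ i, i ≠ e → x i = -N ∧ tip (x, e) i = -N := by
    intro i hi
    simp [x, tip, hi]
  have hmem : (x, e) ∈ dualBoxEdges d N := by
    refine mem_dualBoxEdges.2 ⟨mem_box.2 fun i => ?_, mem_box.2 fun i => ?_⟩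
    · by_cases hi : i = e
      · subst hi; simp only [hxe]; omega
      · simp only [(hx i hi).1]; omega
    · by_cases hi : i = e
      · subst hi; rw [hte]; omega
      · rw [(hx i hi).2]; omega
  have hx1 : x ∉ box d (1 - N) (N - 2) := fun h => by
    have := mem_box.1 h j
    rw [(hx j hj).1] at this
    omega
  have hx2 : tip (x, e) ∉ box d (1 - N) (N - 2) := fun h => by
    have := mem_box.1 h j
    rw [(hx j hj).2] at this
    omega
  have h3 := (h1 x hx1).1 ((h2 _ hmem).2 ((h1 _ hx2).2 hte.ge))
  omega

/-- The axis in direction e joins the two poles of the cube by edges that all touch the interior. -/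
theorem touchingEdges_notMem_hemispheresDisconnected (e : Fin d) {N : ℕ} (hN : 1 ≤ N) :
    touchingEdges (box d (1 - N) (N - 1)) ∉ hemispheresDisconnected d N e := by
  intro h
  have hreach : ∀ k : ℕ, (k : ℤ) ≤ 2 * N →
      (edgeGraph (touchingEdges (box d (1 - N) (N - 1)) : Set (Edge d))).Reachable
        (Pi.single e (-(N : ℤ))) (Pi.single e (-(N : ℤ) + k)) := by
    intro k
    induction k with
    | zero => simp
    | succ k ih =>
      intro hk
      push_cast at hk
      refine (ih (by omega)).trans ?_
      have htip : tip (Pi.single e (-(N : ℤ) + k), e) = Pi.single e (-(N : ℤ) + (k + 1 : ℕ)) := by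
        unfold tip
        rw [← Pi.single_add]
        congr 1
        push_cast
        ring
      have hbox : ∀ t : ℤ, 1 - N ≤ t → t ≤ N - 1 →
          (Pi.single e t : Vertex d) ∈ box d (1 - N) (N - 1) := by
        intro t h1 h2
        refine mem_box.2 fun i => ?_
        by_cases hi : i = e
        · subst hi; rw [Pi.single_eq_same]; omega
        · rw [Pi.single_eq_of_ne hi]; omega
      have hmem : ((Pi.single e (-(N : ℤ) + k), e) : Edge d)
          ∈ touchingEdges (box d (1 - N) (N - 1)) := by
        rw [mem_touchingEdges, htip]
        by_cases hk0 : k = 0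
        · exact Or.inr (hbox _ (by push_cast; omega) (by push_cast; omega))
        · exact Or.inl (hbox _ (by omega) (by omega))
      have := (edgeGraph_adj_of_mem (Finset.mem_coe.2 hmem)).reachable
      rwa [htip] at this
  have hbd : ∀ t : ℤ, (t = -N ∨ t = N) → InBoxBoundary N ((Pi.single e t, ∅) : Cell d) := by
    intro t ht
    refine inBoxBoundary_vertex.2 ⟨mem_box.2 fun i => ?_, fun h => ?_⟩
    · by_cases hi : i = e
      · subst hi; rw [Pi.single_eq_same]; omega
      · rw [Pi.single_eq_of_ne hi]; omega
    · have := mem_box.1 h e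
      rw [Pi.single_eq_same] at this
      omega
  have h1 := hreach (2 * N) (by push_cast; omega)
  rw [show -(N : ℤ) + (2 * N : ℕ) = N by push_cast; ring] at h1
  refine h _ _ (hbd N (Or.inr rfl)) (hbd (-N) (Or.inl rfl)) ?_ ?_ h1.symm
  · rw [Pi.single_eq_same]; omega
  · rw [Pi.single_eq_same]; omega

/-- Both tensions exist, are finite and agree if plaquettes are open with positive probability. -/
theorem exists_common_tension (R : Type*) [Ring R] [Nontrivial R] (hd : 2 ≤ d) (e : Fin d)
    {p q : ℝ} (hp0 : 0 < p) (hp1 : p ≤ 1) (hq : 1 ≤ q) :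
    ∃ L : ℝ, 0 ≤ L ∧ IsWilsonLoopTension R d e p q L ∧
      IsSurfaceTension d e (dualParam p q) q L := by
  have hq0 : 0 < q := by linarith
  have hpq : 0 ≤ (1 - p) * q := mul_nonneg (by linarith) hq0.le
  have hD : 0 < (1 - p) * q + p := by linarith
  have hs0 : 0 ≤ dualParam p q := div_nonneg hpq hD.le
  have hs1 : dualParam p q < 1 := by
    unfold dualParam
    rw [div_lt_one hD]
    linarith
  have ha0 : ∀ N, 0 < cubeSepProb d e (dualParam p q) q N := fun N => sepProb_pos hs0 hs1 hq e _ _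
  have hw0 : ∀ N, 0 < dualBoxSepProb d e (dualParam p q) q N := fun N =>
    sepProb_pos hs0 hs1 hq e _ _
  have hS0 : ∀ N, 1 ≤ N →
      0 < rcmWiredProb d N (dualParam p q) q (hemispheresDisconnected d N e) := fun N hN =>
    (ha0 N).trans_le (cubeSepProb_le_rcmWiredProb hd hs0 hs1 hq e hN)
  obtain ⟨L, hL0, h1, h2⟩ := exists_common_rate (r := 1 - dualParam p q) (M := d - 1)
    (K := 2 * d) (by linarith) (by linarith) ha0
    (fun N => gibbsProb_le_one (isFKGWeight_wiredWeight hs0 hs1 hq _ _).nonneg _) hw0 hS0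
    (fun n N hn hN => cubeSepProb_pow_mul_le hs0 hs1 hq e hn hN)
    (fun N hN => cubeSepProb_mul_le_dualBoxSepProb hs0 hs1 hq e hN)
    (fun N hN => dualBoxSepProb_mul_le_cubeSepProb hs0 hs1 hq e hN)
    (fun N hN => cubeSepProb_le_rcmWiredProb hd hs0 hs1 hq e hN)
    (fun N hN => rcmWiredProb_mul_le_cubeSepProb hd hs0 hs1 hq e hN)
  refine ⟨L, hL0, ?_, tendsto_decayRate hS0 h2⟩
  unfold IsWilsonLoopTension
  simp only [prcmFreeProb_loopBounds hd _ e hq0 hD]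
  exact tendsto_decayRate (fun N _ => hw0 N) h1

/-- If no plaquette is open, both tensions are infinite. -/
theorem tension_eq_top (R : Type*) [Ring R] [Nontrivial R] (hd : 2 ≤ d) (e : Fin d) {q : ℝ}
    (hq : 1 ≤ q) :
    IsWilsonLoopTension R d e 0 q ⊤ ∧ IsSurfaceTension d e (dualParam 0 q) q ⊤ := by
  have hq0 : 0 < q := by linarith
  have hdual : dualParam 0 q = 1 := by
    unfold dualParam
    rw [sub_zero, one_mul, add_zero, div_self hq0.ne']
  constructor
  · refine tendsto_const_nhds.congr' ?_
    filter_upwards [eventually_ge_atTop 1] with N hN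
    rw [prcmFreeProb_loopBounds hd N e hq0 (by linarith), hdual]
    unfold dualBoxSepProb sepProb
    rw [gibbsProb_wiredWeight_one q _ (dualBoxEdges_notMem_separated hd e hN),
      decayRate_zero d hN]
  · rw [hdual]
    refine tendsto_const_nhds.congr' ?_
    filter_upwards [eventually_ge_atTop 1] with N hN
    rw [rcmWiredProb_eq hd hN 1 hq0.ne',
      gibbsProb_wiredWeight_one q _ (touchingEdges_notMem_hemispheresDisconnected e hN),
      decayRate_zero d hN]

end Tension

end

end PRCM

/-! ### The proposition -/

open PRCM
theorem proposition9p3 (R : Type*) [Ring R] [Nontrivial R] (d : ℕ) (hd : 2 ≤ d) (p q : ℝ)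
    (hp0 : 0 ≤ p) (hp1 : p ≤ 1) (hq : 1 ≤ q)
    (huniq : ∃! μ : ProbabilityMeasure (Config d), IsInfiniteVolumePRCM d p q μ) :
    ∃ τ : EReal, 0 ≤ τ ∧ (0 < p → τ ≠ ⊤) ∧
      IsWilsonLoopTension R d ⟨d - 1, by omega⟩ p q τ ∧
      IsSurfaceTension d ⟨d - 1, by omega⟩ (dualParam p q) q τ := by
  -- The case p = 0 means p* = 1, where the closing cost 1 - p* degenerates to zero and the
  -- comparison argument gives nothing.
  rcases hp0.eq_or_lt with rfl | hp
  · obtain ⟨h1, h2⟩ := tension_eq_top R hd ⟨d - 1, by omega⟩ hq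
    exact ⟨⊤, le_top, fun h => absurd h (lt_irrefl 0), h1, h2⟩
  · obtain ⟨L, hL, h1, h2⟩ := exists_common_tension R hd ⟨d - 1, by omega⟩ hp hp1 hq
    exact ⟨L, by exact_mod_cast hL, fun _ => EReal.coe_ne_top L, h1, h2⟩
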